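/- Let $N\in\mathbb N$, let $\mathcal H=L^2(\mathbb R^N)$, and regard the Schwartz space $\mathcal S(\mathbb R^N)$ as a subspace of $\mathcal H$. On $\mathcal S(\mathbb R^N)$ let $(Q_if)(q)=q_if(q)$ and $P_if=-i\,\partial f/\partial q_i$, and for multi-indices $\alpha,\beta\in\mathbb N_0^N$ put $Q^\alpha=Q_1^{\alpha_1}\cdots Q_N^{\alpha_N}$, $P^\beta=P_1^{\beta_1}\cdots P_N^{\beta_N}$ and $\|f\|_{\alpha,\beta}=\|Q^\alpha P^\beta f\|=\big(\int|q^\alpha D^\beta f(q)|^2\,dq\big)^{1/2}$ for $f\in\mathcal S(\mathbb R^N)$. For a bounded operator $T$ on $\mathcal H$ and multi-indices $\alpha,\alpha',\beta,\beta'$ put $$\|T\|_{\alpha,\alpha',\beta,\beta'}=\sup\big\{|\langle P^\beta Q^\alpha\psi\,|\,T P^{\beta'}Q^{\alpha'}\varphi\rangle| \;:\; \psi,\varphi\in\mathcal S(\mathbb R^N),\ \|\psi\|\le1,\ \|\varphi\|\le1\big\}\in[0,\infty].$$ $T$ is called a Schwartz operator if $\|T\|_{\alpha,\alpha',\beta,\beta'}<\infty$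 for all $\alpha,\alpha',\beta,\beta'$. The vector space $\mathcal S(\mathcal H)$ of Schwartz operators carries the locally convex topology induced by all the seminorms $\|\cdot\|_{\alpha,\alpha',\beta,\beta'}$. Theorem. A bounded operator $T$ on $\mathcal H$ is a Schwartz operator if and only if $\mathrm{Ran}(T)\subset\mathcal S(\mathbb R^N)$ and $\mathrm{Ran}(T^*)\subset\mathcal S(\mathbb R^N)$. For every $T\in\mathcal S(\mathcal H)$ and all $\alpha,\beta\in\mathbb N_0^N$, $$\|T\|_{\alpha,0,\beta,0}=\sup_{\varphi\in\mathcal H,\ \|\varphi\|\le1}\|T\varphi\|_{\alpha,\beta},\qquad \|T\|_{0,\alpha,0,\beta}=\sup_{\varphi\in\mathcal H,\ \|\varphi\|\le1}\|T^*\varphi\|_{\alpha,\beta},$$ and the topology of $\mathcal S(\mathcal H)$ is induced by these seminorms alone, where $\alpha,\beta$ range over $\mathbb N_0^N$. -/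

import Mathlib

open MeasureTheory
open scoped SchwartzMap ENNReal

noncomputable section

/-- The Hilbert space `L²(ℝᴺ)` of complex-valued functions. -/
abbrev L2 (N : ℕ) : Type :=
  Lp ℂ 2 (volume : Measure (EuclideanSpace ℝ (Fin N)))

/-- The Schwartz functions `ℝᴺ → ℂ`. -/
abbrev SchwartzFun (N : ℕ) : Type := 𝓢(EuclideanSpace ℝ (Fin N), ℂ)

/-- Multi-indices in `ℕᴺ`. -/
abbrev MultiIdx (N : ℕ) : Type := Fin N → ℕ

/-- The class in `L²(ℝᴺ)` of a Schwartz function. -/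
def toL2 {N : ℕ} (f : SchwartzFun N) : L2 N := f.toLp 2 volume

/-- The Schwartz space as a linear subspace of `L²(ℝᴺ)`. -/
def schwartzSubspace (N : ℕ) : Submodule ℂ (L2 N) :=
  LinearMap.range (SchwartzMap.toLpCLM ℂ ℂ 2 (volume : Measure (EuclideanSpace ℝ (Fin N)))).toLinearMap

/-- The position operator `(Qᵢ f)(q) = qᵢ f(q)` on Schwartz functions. -/
def position {N : ℕ} (i : Fin N) : SchwartzFun N →L[ℂ] SchwartzFun N :=
  SchwartzMap.smulLeftCLM ℂ (fun q : EuclideanSpace ℝ (Fin N) => ((q i : ℝ) : ℂ))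

/-- The momentum operator `Pᵢ f = -i ∂f/∂qᵢ` on Schwartz functions. -/
def momentum {N : ℕ} (i : Fin N) : SchwartzFun N →L[ℂ] SchwartzFun N :=
  (-Complex.I) • LineDeriv.lineDerivOpCLM ℂ (SchwartzFun N) (EuclideanSpace.single i (1 : ℝ))

theorem position_apply {N : ℕ} (i : Fin N) (f : SchwartzFun N) (q : EuclideanSpace ℝ (Fin N)) :
    position i f q = (q i : ℂ) * f q := by
  have h : (fun q : EuclideanSpace ℝ (Fin N) => ((q i : ℝ) : ℂ)).HasTemperateGrowth :=
    (Complex.ofRealCLM.comp (EuclideanSpace.proj (𝕜 := ℝ) i)).hasTemperateGrowth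
  simp [position, SchwartzMap.smulLeftCLM_apply_apply h]

theorem momentum_apply {N : ℕ} (i : Fin N) (f : SchwartzFun N) (q : EuclideanSpace ℝ (Fin N)) :
    momentum i f q = -Complex.I * lineDeriv ℝ f q (EuclideanSpace.single i (1 : ℝ)) := by
  simp [momentum, SchwartzMap.lineDerivOp_apply]

/-- `Q^α = Q₁^α₁ ⋯ Q_N^α_N` on Schwartz functions. -/
def positionPow {N : ℕ} (α : MultiIdx N) : SchwartzFun N →L[ℂ] SchwartzFun N :=
  (List.ofFn fun i => position i ^ α i).prod

/-- `P^β = P₁^β₁ ⋯ P_N^β_N` on Schwartz functions. -/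
def momentumPow {N : ℕ} (β : MultiIdx N) : SchwartzFun N →L[ℂ] SchwartzFun N :=
  (List.ofFn fun i => momentum i ^ β i).prod

/-- The Hilbert space seminorm `‖f‖_{α,β} = ‖Q^α P^β f‖` of a Schwartz function, which is the
`L²` norm of `q^α D^β f`. -/
def vecNorm {N : ℕ} (α β : MultiIdx N) (f : SchwartzFun N) : ℝ :=
  ‖toL2 (positionPow α (momentumPow β f))‖

/-- The Hilbert space norm, in `[0, ∞]`, of the sesquilinear form
`(ψ, φ) ↦ ⟨P^β Q^α ψ, T P^β' Q^α' φ⟩` on Schwartz functions. The arguments are ordered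
`α, α', β, β'`. -/
def opNorm {N : ℕ} (α α' β β' : MultiIdx N) (T : L2 N →L[ℂ] L2 N) : ℝ≥0∞ :=
  ⨆ (ψ : SchwartzFun N) (φ : SchwartzFun N) (_ : ‖toL2 ψ‖ ≤ 1) (_ : ‖toL2 φ‖ ≤ 1),
    ‖inner ℂ (toL2 (momentumPow β (positionPow α ψ)))
      (T (toL2 (momentumPow β' (positionPow α' φ))))‖ₑ

/-- `T` is a Schwartz operator: all the forms above are bounded. -/
def IsSchwartzOperator {N : ℕ} (T : L2 N →L[ℂ] L2 N) : Prop :=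
  ∀ α α' β β' : MultiIdx N, opNorm α α' β β' T < ∞

theorem opNorm_zero {N : ℕ} (α α' β β' : MultiIdx N) :
    opNorm α α' β β' (0 : L2 N →L[ℂ] L2 N) = 0 := by
  simp [opNorm]

theorem opNorm_add_le {N : ℕ} (α α' β β' : MultiIdx N) (S T : L2 N →L[ℂ] L2 N) :
    opNorm α α' β β' (S + T) ≤ opNorm α α' β β' S + opNorm α α' β β' T := by
  refine iSup_le fun ψ => iSup_le fun φ => iSup_le fun hψ => iSup_le fun hφ => ?_
  rw [ContinuousLinearMap.add_apply, inner_add_right]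
  refine (enorm_add_le _ _).trans (add_le_add ?_ ?_)
  · exact le_iSup_of_le ψ (le_iSup_of_le φ (le_iSup_of_le hψ (le_iSup_of_le hφ le_rfl)))
  · exact le_iSup_of_le ψ (le_iSup_of_le φ (le_iSup_of_le hψ (le_iSup_of_le hφ le_rfl)))

theorem opNorm_smul {N : ℕ} (α α' β β' : MultiIdx N) (c : ℂ) (T : L2 N →L[ℂ] L2 N) :
    opNorm α α' β β' (c • T) = ‖c‖ₑ * opNorm α α' β β' T := by
  simp only [opNorm, ENNReal.mul_iSup, ContinuousLinearMap.smul_apply, inner_smul_right, enorm_mul]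

/-- The space of Schwartz operators, as a linear subspace of the bounded operators. -/
def schwartzOperators (N : ℕ) : Submodule ℂ (L2 N →L[ℂ] L2 N) where
  carrier := {T | IsSchwartzOperator T}
  add_mem' hS hT α α' β β' :=
    (opNorm_add_le α α' β β' _ _).trans_lt (ENNReal.add_lt_top.2 ⟨hS α α' β β', hT α α' β β'⟩)
  zero_mem' α α' β β' := by simp [opNorm_zero]
  smul_mem' c T hT α α' β β' := by
    rw [opNorm_smul]
    exact ENNReal.mul_lt_top enorm_lt_top (hT α α' β β')

/-- The vector space `S(H)` of Schwartz operators, without the topology that it would inherit from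
the bounded operators. -/
def SchwartzOperator (N : ℕ) : Type := schwartzOperators N

namespace SchwartzOperator

variable {N : ℕ}

instance : AddCommGroup (SchwartzOperator N) := inferInstanceAs (AddCommGroup (schwartzOperators N))

instance : Module ℂ (SchwartzOperator N) := inferInstanceAs (Module ℂ (schwartzOperators N))

/-- The bounded operator underlying a Schwartz operator. -/
def toCLM : SchwartzOperator N →ₗ[ℂ] (L2 N →L[ℂ] L2 N) := (schwartzOperators N).subtype

theorem isSchwartzOperator (T : SchwartzOperator N) : IsSchwartzOperator T.toCLM := T.2

/-- The seminorm `T ↦ ‖T‖_{α,α',β,β'}` on Schwartz operators. -/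
def seminorm (α α' β β' : MultiIdx N) : Seminorm ℂ (SchwartzOperator N) :=
  Seminorm.of (fun T => (opNorm α α' β β' T.toCLM).toReal)
    (fun S T => by
      rw [map_add, ← ENNReal.toReal_add (S.isSchwartzOperator α α' β β').ne
        (T.isSchwartzOperator α α' β β').ne]
      exact ENNReal.toReal_mono (ENNReal.add_ne_top.2 ⟨(S.isSchwartzOperator α α' β β').ne,
        (T.isSchwartzOperator α α' β β').ne⟩) (opNorm_add_le α α' β β' _ _))
    (fun c T => by rw [map_smul, opNorm_smul, ENNReal.toReal_mul, toReal_enorm])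

/-- The family of all the seminorms `‖·‖_{α,α',β,β'}`. -/
def seminormFamily (N : ℕ) :
    SeminormFamily ℂ (SchwartzOperator N) (MultiIdx N × MultiIdx N × MultiIdx N × MultiIdx N) :=
  fun i => seminorm i.1 i.2.1 i.2.2.1 i.2.2.2

/-- The topology of `S(H)`: the locally convex one induced by all the seminorms
`‖·‖_{α,α',β,β'}`. -/
instance : TopologicalSpace (SchwartzOperator N) := (seminormFamily N).moduleFilterBasis.topology

theorem withSeminorms (N : ℕ) : WithSeminorms (seminormFamily N) := ⟨rfl⟩

/-- The family that consists of the seminorms `‖·‖_{α,0,β,0}` and `‖·‖_{0,α,0,β}` only. -/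
def halfSeminormFamily (N : ℕ) :
    SeminormFamily ℂ (SchwartzOperator N) ((MultiIdx N × MultiIdx N) ⊕ (MultiIdx N × MultiIdx N)) :=
  Sum.elim (fun i => seminorm i.1 0 i.2 0) (fun i => seminorm 0 i.1 0 i.2)

end SchwartzOperator

end

/-! Two mechanisms carry the proof: interpolation between one-sided bounds, and regularity of
vectors with bounded moments.

Interpolation. For self-adjoint bounded `a`, `b`, the operator `(akb)*(akb)` has the same nonzero
spectrum as `(a²k)*(kb²)`, so `‖akb‖² ≤ ‖a²k‖ ‖kb²‖` (`IsSelfAdjoint.norm_mul_mul_sq_le`). The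
unbounded `Q^α` and `P^β` are multiplications by real polynomials, in position space or after a
Fourier transform; cutting the polynomials off extends the inequality to them
(`norm_inner_le_of_isRegularizable`). Hence a form with operators on both sides is bounded by the
larger of two forms in which the operator on one side is doubled and the one on the other side is
removed. Four such interpolations bound `‖T‖_{α,α',β,β'}` by the maximum of six one-sided seminorms
(`FormBound.of_half`). This gives the equality of the topologies, and shows that one-sided bounds
suffice for a Schwartz operator.

Regularity. If `ψ ↦ ⟨P^β Q^α ψ, h⟩` is `L²`-bounded for all `α`, `β`, then normal ordering lets the
adjoint of every polynomial in the `Q_i`, `P_i` be applied to `h`. Momenta give weighted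
integrability of `𝓕⁻ h`, hence a smooth representative of `h`; positions give its decay
(`exists_toL2_eq_of_bounded`). So one-sided bounds place the range in the Schwartz space.
Conversely, if the range lies there, the operators can be moved onto `Tφ`, and uniform boundedness
produces the one-sided bounds (`exists_formBound_of_range`). Statements about `T*` follow by
exchanging the two sides of the form. -/

open scoped FourierTransform InnerProductSpace ComplexConjugate

namespace SchwartzOperator

/-! ### Position and momentum monomials as real multiplication operators -/

section Basics

variable {N : ℕ}

/-- The inclusion of the Schwartz space into `L²(ℝᴺ)` as a linear map. -/
noncomputable def toL2LM (N : ℕ) : SchwartzFun N →ₗ[ℂ] L2 N :=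
  (SchwartzMap.toLpCLM ℂ ℂ 2 (volume : Measure (EuclideanSpace ℝ (Fin N)))).toLinearMap

theorem toL2LM_apply (f : SchwartzFun N) : toL2LM N f = toL2 f := rfl

theorem toL2_add (f g : SchwartzFun N) : toL2 (f + g) = toL2 f + toL2 g :=
  map_add (toL2LM N) f g

theorem toL2_smul (c : ℂ) (f : SchwartzFun N) : toL2 (c • f) = c • toL2 f :=
  map_smul (toL2LM N) c f

theorem toL2_zero : toL2 (0 : SchwartzFun N) = 0 := map_zero (toL2LM N)

theorem denseRange_toL2 : DenseRange (toL2 : SchwartzFun N → L2 N) :=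
  SchwartzMap.denseRange_toLpCLM (E := EuclideanSpace ℝ (Fin N)) (F := ℂ) (p := 2) (by simp)

theorem toL2_injective : Function.Injective (toL2 : SchwartzFun N → L2 N) :=
  SchwartzMap.injective_toLp 2 volume

theorem mem_schwartzSubspace {h : L2 N} : h ∈ schwartzSubspace N ↔ ∃ f, toL2 f = h :=
  LinearMap.mem_range

theorem inner_toL2_left (f : SchwartzFun N) (h : L2 N) :
    ⟪toL2 f, h⟫_ℂ = ∫ x, conj (f x) * h x := by
  rw [L2.inner_def]
  apply integral_congr_ae
  filter_upwards [f.coeFn_toLp 2 volume] with x hx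
  rw [toL2, hx, RCLike.inner_apply, mul_comm]

theorem inner_toL2_toL2 (f g : SchwartzFun N) :
    ⟪toL2 f, toL2 g⟫_ℂ = ∫ x, conj (f x) * g x := by
  simp only [toL2, SchwartzMap.inner_toL2_toL2_eq, RCLike.inner_apply, mul_comm]

theorem toL2_fourierInv (f : SchwartzFun N) : 𝓕⁻ (toL2 f) = toL2 (𝓕⁻ f) :=
  SchwartzMap.toLp_fourierInv_eq f

theorem toL2_fourier (f : SchwartzFun N) : 𝓕 (toL2 f) = toL2 (𝓕 f) :=
  SchwartzMap.toLp_fourier_eq f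

theorem norm_toL2_fourierInv (f : SchwartzFun N) : ‖toL2 (𝓕⁻ f)‖ = ‖toL2 f‖ := by
  rw [← toL2_fourierInv, ← Lp.norm_fourier_eq, FourierTransform.fourier_fourierInv_eq]

theorem inner_fourierInv (f g : L2 N) : ⟪𝓕⁻ f, 𝓕⁻ g⟫_ℂ = ⟪f, g⟫_ℂ := by
  rw [← Lp.inner_fourier_eq, FourierTransform.fourier_fourierInv_eq,
    FourierTransform.fourier_fourierInv_eq]

theorem inner_toL2_fourierInv (f g : SchwartzFun N) :
    ⟪toL2 (𝓕⁻ f), toL2 (𝓕⁻ g)⟫_ℂ = ⟪toL2 f, toL2 g⟫_ℂ := by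
  rw [← toL2_fourierInv, ← toL2_fourierInv, inner_fourierInv]

theorem eq_of_forall_inner_toL2 {h k : L2 N} (H : ∀ ψ : SchwartzFun N, ⟪toL2 ψ, h⟫_ℂ = ⟪toL2 ψ, k⟫_ℂ) :
    h = k := by
  refine ext_inner_left ℂ fun v => ?_
  refine denseRange_toL2.induction_on (p := fun v => ⟪v, h⟫_ℂ = ⟪v, k⟫_ℂ) v
    (isClosed_eq (by fun_prop) (by fun_prop)) H

/-- A bound on all inner products with Schwartz functions is a bound on the norm. -/
theorem norm_le_of_forall_inner_toL2 {h : L2 N} {C : ℝ} (hC : 0 ≤ C)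
    (H : ∀ ψ : SchwartzFun N, ‖⟪toL2 ψ, h⟫_ℂ‖ ≤ C * ‖toL2 ψ‖) : ‖h‖ ≤ C := by
  have H' : ‖⟪h, h⟫_ℂ‖ ≤ C * ‖h‖ := denseRange_toL2.induction_on
    (p := fun v => ‖⟪v, h⟫_ℂ‖ ≤ C * ‖v‖) h (isClosed_le (by fun_prop) (by fun_prop)) H
  rw [inner_self_eq_norm_sq_to_K] at H'
  rcases (norm_nonneg h).eq_or_lt with h0 | h0
  · rwa [← h0]
  · refine le_of_mul_le_mul_right ?_ h0
    simpa [sq] using H'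

/-- The monomial `q ↦ q^α`. -/
def monomial (α : MultiIdx N) (q : EuclideanSpace ℝ (Fin N)) : ℝ := ∏ i, q i ^ α i

theorem monomial_add (α β : MultiIdx N) (q : EuclideanSpace ℝ (Fin N)) :
    monomial (α + β) q = monomial α q * monomial β q := by
  simp [monomial, pow_add, Finset.prod_mul_distrib]

theorem contDiff_monomial (α : MultiIdx N) {n : WithTop ℕ∞} : ContDiff ℝ n (monomial α) := by
  unfold monomial
  fun_prop

theorem position_pow_apply (i : Fin N) (n : ℕ) (f : SchwartzFun N) (q : EuclideanSpace ℝ (Fin N)) :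
    (position i ^ n) f q = (q i : ℂ) ^ n * f q := by
  induction n with
  | zero => simp
  | succ n ih => rw [pow_succ', mul_apply_eq_comp, position_apply, ih]; ring

/-- Used with `ev` the value at a point, for positions, and the value of the inverse Fourier
transform at a point, for momenta. -/
theorem prod_ofFn_apply (A : Fin N → SchwartzFun N →L[ℂ] SchwartzFun N) (a : Fin N → ℂ)
    (ev : SchwartzFun N → ℂ) (H : ∀ i f, ev (A i f) = a i * ev f) (f : SchwartzFun N) :
    ev ((List.ofFn A).prod f) = (∏ i, a i) * ev f := by
  have key (L : List (Fin N)) : ev ((L.map A).prod f) = (L.map a).prod * ev f := by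
    induction L with
    | nil => simp
    | cons i L ih =>
      simp only [List.map_cons, List.prod_cons, mul_apply_eq_comp]
      rw [H, ih, mul_assoc]
  simpa [List.ofFn_eq_map, ← List.prod_ofFn] using key (List.finRange N)

theorem positionPow_apply (α : MultiIdx N) (f : SchwartzFun N) (q : EuclideanSpace ℝ (Fin N)) :
    positionPow α f q = (monomial α q : ℂ) * f q := by
  rw [positionPow, prod_ofFn_apply (fun i => position i ^ α i) (fun i => (q i : ℂ) ^ α i)
    (fun g => g q) (fun i g => position_pow_apply i _ g q)]
  simp [monomial]

/-- On the Fourier side `P_i` is multiplication by a real function. Symmetry and additivity in the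
exponent of `P^β` are therefore proved as for `Q^α`. -/
theorem fourierInv_momentum_apply (i : Fin N) (f : SchwartzFun N)
    (ξ : EuclideanSpace ℝ (Fin N)) :
    𝓕⁻ (momentum i f) ξ = ((-(2 * Real.pi) * ξ i : ℝ) : ℂ) * 𝓕⁻ f ξ := by
  have h : (inner ℝ · (EuclideanSpace.single i (1 : ℝ)) :
    EuclideanSpace ℝ (Fin N) → ℝ).HasTemperateGrowth := by fun_prop
  have : momentum i f = (-Complex.I) • LineDeriv.lineDerivOp (EuclideanSpace.single i (1 : ℝ)) f := rfl
  rw [this, FourierTransform.fourierInv_smul, SchwartzMap.fourierInv_lineDerivOp_eq]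
  simp only [smul_apply, SchwartzMap.smulLeftCLM_apply_apply h]
  simp [EuclideanSpace.inner_single_right]
  ring_nf
  simp [Complex.I_sq]

theorem fourierInv_momentumPow_apply (β : MultiIdx N) (f : SchwartzFun N)
    (ξ : EuclideanSpace ℝ (Fin N)) :
    𝓕⁻ (momentumPow β f) ξ = (monomial β (-(2 * Real.pi) • ξ) : ℂ) * 𝓕⁻ f ξ := by
  have H (i : Fin N) (n : ℕ) (g : SchwartzFun N) : 𝓕⁻ ((momentum i ^ n) g) ξ =
      ((-(2 * Real.pi) * ξ i : ℝ) : ℂ) ^ n * 𝓕⁻ g ξ := by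
    induction n with
    | zero => simp
    | succ n ih =>
      rw [pow_succ', mul_apply_eq_comp, fourierInv_momentum_apply, ih]; ring
  rw [momentumPow, prod_ofFn_apply (fun i => momentum i ^ β i)
    (fun i => ((-(2 * Real.pi) * ξ i : ℝ) : ℂ) ^ β i) (fun g => 𝓕⁻ g ξ) (fun i g => H i _ g)]
  simp [monomial]

theorem inner_positionPow (α : MultiIdx N) (f g : SchwartzFun N) :
    ⟪toL2 (positionPow α f), toL2 g⟫_ℂ = ⟪toL2 f, toL2 (positionPow α g)⟫_ℂ := by
  simp only [inner_toL2_toL2, positionPow_apply, map_mul, Complex.conj_ofReal]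
  congr! 2; ring

theorem inner_momentumPow (β : MultiIdx N) (f g : SchwartzFun N) :
    ⟪toL2 (momentumPow β f), toL2 g⟫_ℂ = ⟪toL2 f, toL2 (momentumPow β g)⟫_ℂ := by
  rw [← inner_toL2_fourierInv, ← inner_toL2_fourierInv f]
  simp only [inner_toL2_toL2, fourierInv_momentumPow_apply, map_mul, Complex.conj_ofReal]
  congr! 2; ring

theorem positionPow_add (α β : MultiIdx N) (f : SchwartzFun N) :
    positionPow (α + β) f = positionPow α (positionPow β f) := by
  ext q; simp [positionPow_apply, monomial_add, mul_assoc]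

theorem fourierInv_injective : Function.Injective (fun f : SchwartzFun N => 𝓕⁻ f) := fun f g h => by
  rw [← FourierTransform.fourier_fourierInv_eq (F := SchwartzFun N) f,
    show 𝓕⁻ f = 𝓕⁻ g from h, FourierTransform.fourier_fourierInv_eq]

theorem momentumPow_add (α β : MultiIdx N) (f : SchwartzFun N) :
    momentumPow (α + β) f = momentumPow α (momentumPow β f) := by
  apply fourierInv_injective
  ext q; simp [fourierInv_momentumPow_apply, monomial_add, mul_assoc]

theorem positionPow_zero (f : SchwartzFun N) : positionPow 0 f = f := by
  ext q; simp [positionPow_apply, monomial]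

theorem momentumPow_zero (f : SchwartzFun N) : momentumPow 0 f = f := by
  apply fourierInv_injective
  ext q; simp [fourierInv_momentumPow_apply, monomial]

theorem positionPow_single (i : Fin N) (f : SchwartzFun N) :
    positionPow (Pi.single i 1) f = position i f := by
  ext q
  simp [positionPow_apply, monomial, position_apply, Pi.single_apply]

theorem momentumPow_single (i : Fin N) (f : SchwartzFun N) :
    momentumPow (Pi.single i 1) f = momentum i f := by
  apply fourierInv_injective
  ext q
  simp [fourierInv_momentumPow_apply, monomial, fourierInv_momentum_apply, Pi.single_apply]

end Basics

end SchwartzOperator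

/-! ### Interpolation between one-sided bounds -/

open Filter Topology

/-- The norm of a two-sided product `a k b` is at most the geometric mean of the norms of the
one-sided products `a² k` and `k b²`. -/
theorem IsSelfAdjoint.norm_mul_mul_sq_le {A : Type*} [CStarAlgebra A] {a b : A}
    (ha : IsSelfAdjoint a) (hb : IsSelfAdjoint b) (k : A) :
    ‖a * k * b‖ ^ 2 ≤ ‖a * a * k‖ * ‖k * (b * b)‖ := by
  cases subsingleton_or_nontrivial A
  · simp [Subsingleton.elim a 0]
  have hX : star (a * k * b) * (a * k * b) = b * (star (a * a * k) * (k * b)) := by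
    simp only [star_mul, ha.star_eq, hb.star_eq, mul_assoc]
  -- The spectra of `xy` and `yx` agree away from `0`, so the left factor `b` may be moved to the
  -- right end. For the self-adjoint `(akb)*(akb)` the spectral radius is the norm.
  have hr : spectralRadius ℂ (b * (star (a * a * k) * (k * b))) ≤
      spectralRadius ℂ (star (a * a * k) * (k * (b * b))) := by
    refine iSup₂_le fun z hz => ?_
    rcases eq_or_ne z 0 with rfl | h0
    · simp
    · have : z ∈ spectrum ℂ (b * (star (a * a * k) * (k * b))) \ {0} := ⟨hz, h0⟩
      rw [spectrum.nonzero_mul_comm] at this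
      have h2 : star (a * a * k) * (k * b) * b = star (a * a * k) * (k * (b * b)) := by
        simp only [mul_assoc]
      rw [h2] at this
      exact le_iSup₂_of_le z this.1 le_rfl
  rw [← hX, (IsSelfAdjoint.star_mul_self _).spectralRadius_eq_nnnorm] at hr
  have h3 := hr.trans (spectrum.spectralRadius_le_nnnorm _)
  have h4 : ‖star (a * k * b) * (a * k * b)‖ ≤ ‖star (a * a * k) * (k * (b * b))‖ := by
    exact_mod_cast h3
  rw [CStarRing.norm_star_mul_self, ← sq] at h4
  exact h4.trans ((norm_mul_le _ _).trans_eq (by rw [norm_star]))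

namespace SchwartzOperator

section Interpolation

variable {N : ℕ}

/-- If the form `ψ ↦ ⟨A ψ, h⟩` is `L²`-bounded, then it is represented by a vector. -/
theorem exists_inner_toL2_eq (A : SchwartzFun N →L[ℂ] SchwartzFun N) (h : L2 N) (C : ℝ)
    (hC : ∀ ψ : SchwartzFun N, ‖⟪toL2 (A ψ), h⟫_ℂ‖ ≤ C * ‖toL2 ψ‖) :
    ∃ h' : L2 N, ∀ ψ : SchwartzFun N, ⟪toL2 ψ, h'⟫_ℂ = ⟪toL2 (A ψ), h⟫_ℂ := by
  let f : SchwartzFun N →ₗ[ℂ] ℂ := (innerSL ℂ h).toLinearMap ∘ₗ toL2LM N ∘ₗ A.toLinearMap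
  have hf (ψ : SchwartzFun N) : f ψ = ⟪h, toL2 (A ψ)⟫_ℂ := rfl
  refine ⟨(InnerProductSpace.toDual ℂ (L2 N)).symm (f.extendOfNorm (toL2LM N)), fun ψ => ?_⟩
  rw [← inner_conj_symm, InnerProductSpace.toDual_symm_apply, ← toL2LM_apply ψ,
    LinearMap.extendOfNorm_eq denseRange_toL2, hf, inner_conj_symm]
  exact ⟨C, fun ψ => by rw [hf, norm_inner_symm]; exact hC ψ⟩

/-- A bounded sesquilinear form on the Schwartz space is given by a bounded operator. -/
theorem exists_clm_inner_toL2_eq (A B : SchwartzFun N →L[ℂ] SchwartzFun N) (K : L2 N →L[ℂ] L2 N)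
    {C : ℝ} (hC : 0 ≤ C) (H : ∀ ψ φ : SchwartzFun N,
      ‖⟪toL2 (A ψ), K (toL2 (B φ))⟫_ℂ‖ ≤ C * ‖toL2 ψ‖ * ‖toL2 φ‖) :
    ∃ K' : L2 N →L[ℂ] L2 N, ∀ ψ φ : SchwartzFun N,
      ⟪toL2 ψ, K' (toL2 φ)⟫_ℂ = ⟪toL2 (A ψ), K (toL2 (B φ))⟫_ℂ := by
  choose w hw using fun φ => exists_inner_toL2_eq A (K (toL2 (B φ))) (C * ‖toL2 φ‖)
    (fun ψ => (H ψ φ).trans_eq (by ring))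
  let f : SchwartzFun N →ₗ[ℂ] L2 N :=
    { toFun := w
      map_add' := fun φ φ' => eq_of_forall_inner_toL2 fun ψ => by
        rw [inner_add_right, hw, hw, hw, map_add, toL2_add, map_add, inner_add_right]
      map_smul' := fun c φ => eq_of_forall_inner_toL2 fun ψ => by
        rw [RingHom.id_apply, inner_smul_right, hw, hw, map_smul, toL2_smul, map_smul,
          inner_smul_right] }
  have hf (φ : SchwartzFun N) : ‖f φ‖ ≤ C * ‖toL2LM N φ‖ :=
    norm_le_of_forall_inner_toL2 (by positivity) fun ψ => by
      change ‖⟪toL2 ψ, w φ⟫_ℂ‖ ≤ _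
      rw [hw]; exact (H ψ φ).trans_eq (by rw [toL2LM_apply]; ring)
  refine ⟨f.extendOfNorm (toL2LM N), fun ψ φ => ?_⟩
  rw [← toL2LM_apply φ, LinearMap.extendOfNorm_eq denseRange_toL2 ⟨C, hf⟩, ← hw]
  rfl

theorem opNorm_le_of_forall_inner_toL2 {K : L2 N →L[ℂ] L2 N} {C : ℝ} (hC : 0 ≤ C)
    (H : ∀ ψ φ : SchwartzFun N, ‖⟪toL2 ψ, K (toL2 φ)⟫_ℂ‖ ≤ C * ‖toL2 ψ‖ * ‖toL2 φ‖) : ‖K‖ ≤ C := by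
  refine K.opNorm_le_bound hC fun φ => ?_
  refine denseRange_toL2.induction_on (p := fun φ => ‖K φ‖ ≤ C * ‖φ‖) φ
    (isClosed_le (by fun_prop) (by fun_prop)) fun φ => ?_
  exact norm_le_of_forall_inner_toL2 (by positivity) fun ψ => (H ψ φ).trans_eq (by ring)

theorem isSelfAdjoint_of_inner_toL2 {K : L2 N →L[ℂ] L2 N}
    (H : ∀ ψ φ : SchwartzFun N, ⟪toL2 ψ, K (toL2 φ)⟫_ℂ = ⟪K (toL2 ψ), toL2 φ⟫_ℂ) :
    IsSelfAdjoint K := by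
  rw [ContinuousLinearMap.isSelfAdjoint_iff_isSymmetric]
  intro u v
  refine (denseRange_toL2.induction_on (p := fun u => ⟪K u, v⟫_ℂ = ⟪u, K v⟫_ℂ) u
    (isClosed_eq (by fun_prop) (by fun_prop)) fun ψ => ?_)
  exact (denseRange_toL2.induction_on (p := fun v => ⟪K (toL2 ψ), v⟫_ℂ = ⟪toL2 ψ, K v⟫_ℂ) v
    (isClosed_eq (by fun_prop) (by fun_prop)) fun φ => (H ψ φ).symm)

theorem norm_toL2_le_mul {f g : SchwartzFun N} {c : ℝ} (H : ∀ x, ‖f x‖ ≤ c * ‖g x‖) :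
    ‖toL2 f‖ ≤ c * ‖toL2 g‖ := by
  refine Lp.norm_le_mul_norm_of_ae_le_mul ?_
  filter_upwards [f.coeFn_toLp 2 volume, g.coeFn_toLp 2 volume] with x hf hg
  rw [toL2, toL2, hf, hg]
  exact H x

/-- A symmetric operator on the Schwartz space which is the strong limit of bounded
self-adjoint operators whose squares are dominated by the square of the operator. -/
def IsRegularizable (A : SchwartzFun N →L[ℂ] SchwartzFun N) : Prop :=
  ∃ a : ℕ → L2 N →L[ℂ] L2 N, (∀ n, IsSelfAdjoint (a n)) ∧
    (∀ ψ : SchwartzFun N, Tendsto (fun n => a n (toL2 ψ)) atTop (𝓝 (toL2 (A ψ)))) ∧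
    ∀ n (ψ : SchwartzFun N), ∃ ψ' : SchwartzFun N,
      ‖toL2 ψ'‖ ≤ ‖toL2 ψ‖ ∧ a n (a n (toL2 ψ)) = toL2 (A (A ψ'))

/-- The regularizations satisfy `a_n² ψ = A² ψ'` with `‖ψ'‖ ≤ ‖ψ‖`, so the hypotheses give `‖a_n² K‖
≤ C` and `‖K b_n²‖ ≤ C` uniformly in `n`. The C*-inequality gives `‖a_n K b_n‖ ≤ C`, and strong
convergence on Schwartz vectors passes this to the limit. -/
theorem norm_inner_le_of_isRegularizable {A B : SchwartzFun N →L[ℂ] SchwartzFun N}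
    (hA : IsRegularizable A) (hB : IsRegularizable B) {K : L2 N →L[ℂ] L2 N} {C : ℝ} (hC : 0 ≤ C)
    (HA : ∀ ψ φ : SchwartzFun N,
      ‖⟪toL2 (A (A ψ)), K (toL2 φ)⟫_ℂ‖ ≤ C * ‖toL2 ψ‖ * ‖toL2 φ‖)
    (HB : ∀ ψ φ : SchwartzFun N,
      ‖⟪toL2 ψ, K (toL2 (B (B φ)))⟫_ℂ‖ ≤ C * ‖toL2 ψ‖ * ‖toL2 φ‖) (ψ φ : SchwartzFun N) :
    ‖⟪toL2 (A ψ), K (toL2 (B φ))⟫_ℂ‖ ≤ C * ‖toL2 ψ‖ * ‖toL2 φ‖ := by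
  obtain ⟨a, ha, ha', ha''⟩ := hA
  obtain ⟨b, hb, hb', hb''⟩ := hB
  have h1 (n : ℕ) : ‖a n * a n * K‖ ≤ C := by
    refine opNorm_le_of_forall_inner_toL2 hC fun ψ φ => ?_
    obtain ⟨ψ', hψ', e⟩ := ha'' n ψ
    have hs (u v : L2 N) : ⟪u, a n v⟫_ℂ = ⟪a n u, v⟫_ℂ :=
      ((ha n).isSymmetric u v).symm
    simp only [mul_apply_eq_comp, hs]
    rw [e]
    exact (HA ψ' φ).trans (by gcongr)
  have h2 (n : ℕ) : ‖K * (b n * b n)‖ ≤ C := by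
    refine opNorm_le_of_forall_inner_toL2 hC fun ψ φ => ?_
    obtain ⟨φ', hφ', e⟩ := hb'' n φ
    simp only [mul_apply_eq_comp]
    rw [e]
    exact (HB ψ φ').trans (by gcongr)
  have h3 (n : ℕ) : ‖a n * K * b n‖ ≤ C := by
    refine le_of_sq_le_sq ?_ hC
    calc _ ≤ _ := (ha n).norm_mul_mul_sq_le (hb n) K
      _ ≤ C * C := by gcongr <;> [exact h1 n; exact h2 n]
      _ = C ^ 2 := (sq C).symm
  have h4 : Tendsto (fun n => ‖⟪a n (toL2 ψ), K (b n (toL2 φ))⟫_ℂ‖) atTop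
      (𝓝 ‖⟪toL2 (A ψ), K (toL2 (B φ))⟫_ℂ‖) :=
    ((ha' ψ).inner ((K.continuous.tendsto _).comp (hb' φ))).norm
  refine le_of_tendsto' h4 fun n => ?_
  have hs : ⟪a n (toL2 ψ), K (b n (toL2 φ))⟫_ℂ = ⟪toL2 ψ, (a n * K * b n) (toL2 φ)⟫_ℂ :=
    (ha n).isSymmetric _ _
  rw [hs]
  calc _ ≤ ‖toL2 ψ‖ * ‖(a n * K * b n) (toL2 φ)‖ := norm_inner_le_norm _ _
    _ ≤ ‖toL2 ψ‖ * (C * ‖toL2 φ‖) := by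
      gcongr; exact ContinuousLinearMap.le_of_opNorm_le _ (h3 n) _
    _ = _ := by ring

/-- A smooth cutoff which is `1` on the ball of radius `n + 1`. -/
noncomputable def cutoff (N n : ℕ) : ContDiffBump (0 : EuclideanSpace ℝ (Fin N)) :=
  ⟨n + 1, n + 2, by positivity, by linarith⟩

theorem abs_one_sub_cutoff_le (n : ℕ) (x : EuclideanSpace ℝ (Fin N)) :
    |1 - cutoff N n x| ≤ (n + 1 : ℝ)⁻¹ * (1 + ‖x‖ ^ 2) := by
  have hn : (0 : ℝ) < n + 1 := by positivity
  rcases le_or_gt ‖x‖ (n + 1) with h | h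
  · rw [(cutoff N n).one_of_mem_closedBall (by simpa [cutoff] using h)]
    simp only [sub_self, abs_zero]
    positivity
  · rw [abs_of_nonneg (sub_nonneg.2 (cutoff N n).le_one), inv_mul_eq_div, le_div_iff₀ hn]
    have := (cutoff N n).nonneg' x
    nlinarith

theorem isRegularizable_of_apply {A : SchwartzFun N →L[ℂ] SchwartzFun N}
    {m : EuclideanSpace ℝ (Fin N) → ℝ} (hm : ContDiff ℝ ((⊤ : ℕ∞) : WithTop ℕ∞) m)
    (hA : ∀ f x, A f x = (m x : ℂ) * f x) : IsRegularizable A := by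
  have hcs (n : ℕ) : HasCompactSupport fun x => m x * cutoff N n x :=
    (cutoff N n).hasCompactSupport.mul_left
  have hcd (n : ℕ) : ContDiff ℝ ((⊤ : ℕ∞) : WithTop ℕ∞) fun x => m x * cutoff N n x :=
    hm.mul (cutoff N n).contDiff
  have htg (n : ℕ) : (fun x => ((m x * cutoff N n x : ℝ) : ℂ)).HasTemperateGrowth :=
    Function.Complex.hasTemperateGrowth_ofReal.comp ((hcs n).hasTemperateGrowth (hcd n))
  have hχ (n : ℕ) : (fun x => ((cutoff N n x : ℝ) : ℂ)).HasTemperateGrowth :=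
    Function.Complex.hasTemperateGrowth_ofReal.comp
      ((cutoff N n).hasCompactSupport.hasTemperateGrowth (cutoff N n).contDiff)
  let M (n : ℕ) : SchwartzFun N →L[ℂ] SchwartzFun N :=
    SchwartzMap.smulLeftCLM ℂ fun x => ((m x * cutoff N n x : ℝ) : ℂ)
  let X (n : ℕ) : SchwartzFun N →L[ℂ] SchwartzFun N :=
    SchwartzMap.smulLeftCLM ℂ fun x => ((cutoff N n x : ℝ) : ℂ)
  have hM (n : ℕ) (f : SchwartzFun N) (x) : M n f x = ((m x * cutoff N n x : ℝ) : ℂ) * f x :=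
    SchwartzMap.smulLeftCLM_apply_apply (htg n) f x
  have hX (n : ℕ) (f : SchwartzFun N) (x) : X n f x = ((cutoff N n x : ℝ) : ℂ) * f x :=
    SchwartzMap.smulLeftCLM_apply_apply (hχ n) f x
  have hb (n : ℕ) : ∃ C : ℝ, ∀ x, ‖m x * cutoff N n x‖ ≤ C :=
    (hcs n).exists_bound_of_continuous (hcd n).continuous
  choose C hC using hb
  have hC0 (n : ℕ) : 0 ≤ C n := (norm_nonneg _).trans (hC n 0)
  have hMC (n : ℕ) (f : SchwartzFun N) : ‖toL2 (M n f)‖ ≤ C n * ‖toL2 f‖ :=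
    norm_toL2_le_mul fun x => by
      rw [hM, norm_mul, Complex.norm_real]
      gcongr
      exact hC n x
  choose a ha using fun n => exists_clm_inner_toL2_eq (ContinuousLinearMap.id ℂ _) (M n)
    (1 : L2 N →L[ℂ] L2 N) (hC0 n) fun ψ φ => by
      refine (norm_inner_le_norm _ _).trans ?_
      calc _ ≤ ‖toL2 ψ‖ * (C n * ‖toL2 φ‖) :=
          mul_le_mul_of_nonneg_left (hMC n φ) (norm_nonneg _)
        _ = _ := by ring
  have ha' (n : ℕ) (f : SchwartzFun N) : a n (toL2 f) = toL2 (M n f) :=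
    eq_of_forall_inner_toL2 fun ψ => ha n ψ f
  refine ⟨a, fun n => isSelfAdjoint_of_inner_toL2 fun ψ φ => ?_, fun ψ => ?_, fun n ψ => ?_⟩
  · rw [ha', ha']
    simp only [inner_toL2_toL2, hM, map_mul, Complex.conj_ofReal]
    congr! 2; ring
  -- The error is `(1 - χ_n) Aψ`; since `|1 - χ_n| ≤ (1 + ‖x‖²)/(n + 1)`, its norm is at most that
  -- of the Schwartz function `(1 + ‖x‖²) Aψ`, divided by `n + 1`.
  · have hw : (fun x : EuclideanSpace ℝ (Fin N) => ((1 + ‖x‖ ^ 2 : ℝ) : ℂ)).HasTemperateGrowth := by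
      refine Function.Complex.hasTemperateGrowth_ofReal.comp (Function.HasTemperateGrowth.add ?_ ?_)
      · exact Function.HasTemperateGrowth.const 1
      · exact Function.hasTemperateGrowth_norm_sq _
    let g : SchwartzFun N :=
      SchwartzMap.smulLeftCLM ℂ (fun x => ((1 + ‖x‖ ^ 2 : ℝ) : ℂ)) (A ψ)
    have hg (x) : g x = ((1 + ‖x‖ ^ 2 : ℝ) : ℂ) * A ψ x :=
      SchwartzMap.smulLeftCLM_apply_apply hw (A ψ) x
    have hle (n : ℕ) : ‖a n (toL2 ψ) - toL2 (A ψ)‖ ≤ (n + 1 : ℝ)⁻¹ * ‖toL2 g‖ := by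
      rw [ha', norm_sub_rev, ← toL2LM_apply, ← toL2LM_apply, ← map_sub]
      refine norm_toL2_le_mul fun x => ?_
      rw [sub_apply, hM, hg, hA, norm_mul _ ((m x : ℂ) * ψ x), ← mul_assoc,
        show (m x : ℂ) * ψ x - ((m x * cutoff N n x : ℝ) : ℂ) * ψ x =
          ((1 - cutoff N n x : ℝ) : ℂ) * ((m x : ℂ) * ψ x) by push_cast; ring, norm_mul,
        Complex.norm_real, Complex.norm_real]
      gcongr
      refine (abs_one_sub_cutoff_le n x).trans ?_
      gcongr
      exact le_abs_self _
    rw [tendsto_iff_norm_sub_tendsto_zero]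
    refine squeeze_zero (fun _ => norm_nonneg _) hle ?_
    have := (tendsto_one_div_add_atTop_nhds_zero_nat (𝕜 := ℝ)).mul_const ‖toL2 g‖
    simpa using this
  -- `(m χ_n)² ψ = m² (χ_n² ψ)`, and multiplication by `χ_n²` is a contraction because `0 ≤ χ_n ≤
  -- 1`.
  · refine ⟨X n (X n ψ), ?_, ?_⟩
    · refine (norm_toL2_le_mul (c := 1) fun x => ?_).trans_eq (one_mul _)
      have h0 := (cutoff N n).nonneg' x
      have h1 := (cutoff N n).le_one (x := x)
      rw [hX, hX, ← mul_assoc, norm_mul, norm_mul, Complex.norm_real, Real.norm_of_nonneg h0]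
      gcongr
      exact mul_le_one₀ h1 h0 h1
    · rw [ha', ha']
      congr 1
      ext x
      simp only [hM, hX, hA]
      push_cast
      ring

theorem isRegularizable_positionPow (α : MultiIdx N) : IsRegularizable (positionPow α) :=
  isRegularizable_of_apply (contDiff_monomial α) (positionPow_apply α)

theorem inner_fourierInv_left (u v : L2 N) : ⟪𝓕⁻ u, v⟫_ℂ = ⟪u, 𝓕 v⟫_ℂ := by
  rw [← inner_fourierInv u, FourierTransform.fourierInv_fourier_eq]

/-- Regularizability is preserved under conjugation with the Fourier transform. -/
theorem IsRegularizable.conj_fourier {A M : SchwartzFun N →L[ℂ] SchwartzFun N}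
    (hM : IsRegularizable M) (h : ∀ f, 𝓕⁻ (A f) = M (𝓕⁻ f)) : IsRegularizable A := by
  obtain ⟨a, ha, ha', ha''⟩ := hM
  have hA (f : SchwartzFun N) : toL2 (A f) = 𝓕 (toL2 (M (𝓕⁻ f))) := by
    rw [← h, toL2_fourier, FourierTransform.fourier_fourierInv_eq]
  let F := Lp.fourierTransformₗᵢ (EuclideanSpace ℝ (Fin N)) ℂ
  let b (n : ℕ) : L2 N →L[ℂ] L2 N :=
    (F : L2 N →L[ℂ] L2 N) ∘L a n ∘L (F.symm : L2 N →L[ℂ] L2 N)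
  have hb (n : ℕ) (u : L2 N) : b n u = 𝓕 (a n (𝓕⁻ u)) := rfl
  refine ⟨b, fun n => ?_, fun ψ => ?_, fun n ψ => ?_⟩
  · rw [ContinuousLinearMap.isSelfAdjoint_iff_isSymmetric]
    intro u v
    change ⟪b n u, v⟫_ℂ = ⟪u, b n v⟫_ℂ
    rw [hb, hb, ← inner_fourierInv_left, ← inner_fourierInv _ v,
      FourierTransform.fourierInv_fourier_eq]
    exact (ha n).isSymmetric _ _
  · simp only [hb, hA, toL2_fourierInv]
    exact ((ContinuousFourier.continuous_fourier (E := L2 N)).tendsto _).comp (ha' (𝓕⁻ ψ))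
  · obtain ⟨ψ', hψ', e⟩ := ha'' n (𝓕⁻ ψ)
    refine ⟨𝓕 ψ', ?_, ?_⟩
    · rw [← toL2_fourier, Lp.norm_fourier_eq]
      rwa [norm_toL2_fourierInv] at hψ'
    · rw [hb, hb, FourierTransform.fourierInv_fourier_eq, toL2_fourierInv, e, hA, h,
        FourierTransform.fourierInv_fourier_eq]

theorem isRegularizable_momentumPow (β : MultiIdx N) : IsRegularizable (momentumPow β) := by
  have hc : ContDiff ℝ ((⊤ : ℕ∞) : WithTop ℕ∞) fun ξ : EuclideanSpace ℝ (Fin N) =>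
      monomial β (-(2 * Real.pi) • ξ) :=
    (contDiff_monomial β).comp (contDiff_const_smul _)
  -- `P^β` transported to frequency space, where it is multiplication by a real polynomial.
  let M : SchwartzFun N →L[ℂ] SchwartzFun N :=
    FourierTransform.fourierInvCLM ℂ (SchwartzFun N) ∘L momentumPow β ∘L
      FourierTransform.fourierCLM ℂ (SchwartzFun N)
  have hM (f : SchwartzFun N) : M f = 𝓕⁻ (momentumPow β (𝓕 f)) := rfl
  refine (isRegularizable_of_apply (A := M) hc fun f ξ => ?_).conj_fourier fun f => ?_
  · rw [hM, fourierInv_momentumPow_apply, FourierTransform.fourierInv_fourier_eq]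
  · rw [hM, FourierTransform.fourier_fourierInv_eq]

end Interpolation

end SchwartzOperator

namespace SchwartzOperator

/-! ### From one-sided to two-sided seminorms -/

section FormBounds

variable {N : ℕ}

/-- The form `(ψ, φ) ↦ ⟨P^β Q^α ψ, T P^β' Q^α' φ⟩` is bounded by `C`. -/
def FormBound (T : L2 N →L[ℂ] L2 N) (C : ℝ) (α α' β β' : MultiIdx N) : Prop :=
  ∀ ψ φ : SchwartzFun N, ‖⟪toL2 (momentumPow β (positionPow α ψ)),
    T (toL2 (momentumPow β' (positionPow α' φ)))⟫_ℂ‖ ≤ C * ‖toL2 ψ‖ * ‖toL2 φ‖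

theorem opNorm_le_ofReal_iff {T : L2 N →L[ℂ] L2 N} {C : ℝ} (hC : 0 ≤ C) {α α' β β' : MultiIdx N} :
    opNorm α α' β β' T ≤ ENNReal.ofReal C ↔ FormBound T C α α' β β' := by
  constructor
  · intro h ψ φ
    rcases eq_or_ne ψ 0 with rfl | hψ
    · simp [toL2_zero]
    rcases eq_or_ne φ 0 with rfl | hφ
    · simp [toL2_zero]
    have hψ' : 0 < ‖toL2 ψ‖ := norm_pos_iff.2 fun h => hψ (toL2_injective (h.trans toL2_zero.symm))
    have hφ' : 0 < ‖toL2 φ‖ := norm_pos_iff.2 fun h => hφ (toL2_injective (h.trans toL2_zero.symm))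
    -- Both arguments are normalised to unit vectors and the scalars are pulled out again.
    have key := (iSup_le_iff.1 (iSup_le_iff.1 (iSup_le_iff.1 (iSup_le_iff.1 h
      (((‖toL2 ψ‖⁻¹ : ℝ) : ℂ) • ψ)) (((‖toL2 φ‖⁻¹ : ℝ) : ℂ) • φ))
      (by rw [toL2_smul, norm_smul, Complex.norm_real, norm_inv, norm_norm,
        inv_mul_cancel₀ hψ'.ne']))
      (by rw [toL2_smul, norm_smul, Complex.norm_real, norm_inv, norm_norm,
        inv_mul_cancel₀ hφ'.ne']))
    rw [← ofReal_norm, ENNReal.ofReal_le_ofReal_iff hC] at key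
    simp only [map_smul, toL2_smul, inner_smul_left, inner_smul_right, norm_mul, RCLike.norm_conj,
      Complex.norm_real, norm_inv, norm_norm] at key
    rw [inv_mul_le_iff₀ hφ', inv_mul_le_iff₀ hψ'] at key
    linarith
  · intro h
    refine iSup_le fun ψ => iSup_le fun φ => iSup_le fun hψ => iSup_le fun hφ => ?_
    rw [← ofReal_norm]
    refine ENNReal.ofReal_le_ofReal ((h ψ φ).trans ?_)
    rw [mul_assoc]
    exact mul_le_of_le_one_right hC (mul_le_one₀ hψ (norm_nonneg _) hφ)

theorem FormBound.mono {T : L2 N →L[ℂ] L2 N} {C C' : ℝ} {α α' β β' : MultiIdx N}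
    (h : FormBound T C α α' β β') (hC : C ≤ C') : FormBound T C' α α' β β' :=
  fun ψ φ => (h ψ φ).trans (by gcongr)

theorem opNorm_lt_top_iff {T : L2 N →L[ℂ] L2 N} {α α' β β' : MultiIdx N} :
    opNorm α α' β β' T < ∞ ↔ ∃ C, FormBound T C α α' β β' := by
  constructor
  · intro h
    refine ⟨(opNorm α α' β β' T).toReal, ?_⟩
    rw [← opNorm_le_ofReal_iff ENNReal.toReal_nonneg, ENNReal.ofReal_toReal h.ne]
  · rintro ⟨C, h⟩
    exact ((opNorm_le_ofReal_iff (le_max_right C 0)).2 (h.mono (le_max_left C 0))).trans_lt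
      ENNReal.ofReal_lt_top

/-- The outer operators `X`, `Y` are absorbed into a bounded operator `K` representing their form.
The bound `C'` only serves the existence of `K` and does not enter the conclusion. -/
theorem norm_inner_le_of_isRegularizable_comp {L R X Y : SchwartzFun N →L[ℂ] SchwartzFun N}
    (hL : IsRegularizable L) (hR : IsRegularizable R) {T : L2 N →L[ℂ] L2 N} {C : ℝ} (hC : 0 ≤ C)
    (H : ∃ C', ∀ ψ φ : SchwartzFun N,
      ‖⟪toL2 (X ψ), T (toL2 (Y φ))⟫_ℂ‖ ≤ C' * ‖toL2 ψ‖ * ‖toL2 φ‖)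
    (HL : ∀ ψ φ : SchwartzFun N,
      ‖⟪toL2 (X (L (L ψ))), T (toL2 (Y φ))⟫_ℂ‖ ≤ C * ‖toL2 ψ‖ * ‖toL2 φ‖)
    (HR : ∀ ψ φ : SchwartzFun N,
      ‖⟪toL2 (X ψ), T (toL2 (Y (R (R φ))))⟫_ℂ‖ ≤ C * ‖toL2 ψ‖ * ‖toL2 φ‖) (ψ φ : SchwartzFun N) :
    ‖⟪toL2 (X (L ψ)), T (toL2 (Y (R φ)))⟫_ℂ‖ ≤ C * ‖toL2 ψ‖ * ‖toL2 φ‖ := by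
  obtain ⟨C', H⟩ := H
  obtain ⟨K, hK⟩ := exists_clm_inner_toL2_eq X Y T (le_max_right C' 0) fun ψ φ =>
    (H ψ φ).trans (by gcongr; exact le_max_left _ _)
  simp only [← hK] at HL HR ⊢
  exact norm_inner_le_of_isRegularizable hL hR hC HL HR ψ φ

/-- One-sided bounds imply the two-sided ones, with control of the constant. -/
theorem FormBound.of_half {T : L2 N →L[ℂ] L2 N} (hl : ∀ α β, ∃ C, FormBound T C α 0 β 0)
    (hr : ∀ α β, ∃ C, FormBound T C 0 α 0 β) {C : ℝ} (hC : 0 ≤ C) {α α' β β' : MultiIdx N}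
    (h₁ : FormBound T C (α + α + (α + α)) 0 β 0) (h₂ : FormBound T C 0 0 (β + β) 0)
    (h₃ : FormBound T C 0 0 (β + β + (β + β)) 0)
    (h₄ : FormBound T C 0 (α' + α' + (α' + α')) 0 β') (h₅ : FormBound T C 0 0 0 (β' + β'))
    (h₆ : FormBound T C 0 0 0 (β' + β' + (β' + β'))) : FormBound T C α α' β β' := by
  -- Only the operator acting directly on `ψ` or `φ` is doubled, so no commutation is needed. The
  -- order is: `P^β` against `P^β'`; `Q^(2α)` against `P^β'` inside `P^β`; `P^β` against `Q^(2α')`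
  -- inside `P^β'`; finally `Q^α` against `Q^α'`. The doubled position powers explain the exponents
  -- `4α` and `4α'` in the hypotheses.
  have pp {C : ℝ} (hC : 0 ≤ C) {β β' : MultiIdx N} (h : FormBound T C 0 0 (β + β) 0)
      (h' : FormBound T C 0 0 0 (β' + β')) : FormBound T C 0 0 β β' := by
    intro ψ φ
    simp only [FormBound, momentumPow_add, positionPow_zero, momentumPow_zero] at h h' ⊢
    exact norm_inner_le_of_isRegularizable (isRegularizable_momentumPow β)
      (isRegularizable_momentumPow β') hC h h' ψ φ
  have pp' (β β' : MultiIdx N) : ∃ C, FormBound T C 0 0 β β' := by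
    obtain ⟨C₁, h₁⟩ := hl 0 (β + β)
    obtain ⟨C₂, h₂⟩ := hr 0 (β' + β')
    exact ⟨max 0 (max C₁ C₂), pp (le_max_left _ _)
      (h₁.mono ((le_max_left _ _).trans (le_max_right _ _)))
      (h₂.mono ((le_max_right _ _).trans (le_max_right _ _)))⟩
  have qpp : FormBound T C (α + α) 0 β β' := by
    obtain ⟨C', H⟩ := hl 0 β
    have h := pp hC h₂ h₆
    intro ψ φ
    simp only [FormBound, momentumPow_add, positionPow_add (α + α), positionPow_zero,
      momentumPow_zero] at h h₁ H ⊢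
    exact norm_inner_le_of_isRegularizable_comp (X := momentumPow β)
      (Y := ContinuousLinearMap.id ℂ _)
      (isRegularizable_positionPow (α + α)) (isRegularizable_momentumPow β') hC ⟨C', H⟩ h₁ h ψ φ
  have ppq : FormBound T C 0 (α' + α') β β' := by
    obtain ⟨C', H⟩ := hr 0 β'
    have h := pp hC h₃ h₅
    intro ψ φ
    simp only [FormBound, momentumPow_add, positionPow_add (α' + α'), positionPow_zero,
      momentumPow_zero] at h h₄ H ⊢
    exact norm_inner_le_of_isRegularizable_comp (X := ContinuousLinearMap.id ℂ _)
      (Y := momentumPow β')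
      (isRegularizable_momentumPow β) (isRegularizable_positionPow (α' + α')) hC ⟨C', H⟩ h h₄ ψ φ
  obtain ⟨C', H⟩ := pp' β β'
  intro ψ φ
  simp only [FormBound, positionPow_add, positionPow_zero] at qpp ppq H ⊢
  exact norm_inner_le_of_isRegularizable_comp (X := momentumPow β) (Y := momentumPow β')
    (isRegularizable_positionPow α) (isRegularizable_positionPow α') hC ⟨C', H⟩ qpp ppq ψ φ

theorem isSchwartzOperator_of_half {T : L2 N →L[ℂ] L2 N}
    (hl : ∀ α β, ∃ C, FormBound T C α 0 β 0) (hr : ∀ α β, ∃ C, FormBound T C 0 α 0 β) :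
    IsSchwartzOperator T := by
  intro α α' β β'
  obtain ⟨C₁, h₁⟩ := hl (α + α + (α + α)) β
  obtain ⟨C₂, h₂⟩ := hl 0 (β + β)
  obtain ⟨C₃, h₃⟩ := hl 0 (β + β + (β + β))
  obtain ⟨C₄, h₄⟩ := hr (α' + α' + (α' + α')) β'
  obtain ⟨C₅, h₅⟩ := hr 0 (β' + β')
  obtain ⟨C₆, h₆⟩ := hr 0 (β' + β' + (β' + β'))
  refine opNorm_lt_top_iff.2 ⟨|C₁| + |C₂| + |C₃| + |C₄| + |C₅| + |C₆|,
    FormBound.of_half hl hr (by positivity) (h₁.mono ?_) (h₂.mono ?_) (h₃.mono ?_) (h₄.mono ?_)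
      (h₅.mono ?_) (h₆.mono ?_)⟩ <;>
  linarith [le_abs_self C₁, le_abs_self C₂, le_abs_self C₃, le_abs_self C₄, le_abs_self C₅,
    le_abs_self C₆, abs_nonneg C₁, abs_nonneg C₂, abs_nonneg C₃, abs_nonneg C₄, abs_nonneg C₅,
    abs_nonneg C₆]

theorem withSeminorms_halfSeminormFamily (N : ℕ) : WithSeminorms (halfSeminormFamily N) := by
  have hsn (α α' β β' : MultiIdx N) (T : SchwartzOperator N) (C : ℝ) (h : seminorm α α' β β' T ≤ C) :
      FormBound T.toCLM C α α' β β' := by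
    rw [← opNorm_le_ofReal_iff ((apply_nonneg _ _).trans h)]
    exact (ENNReal.le_ofReal_iff_toReal_le (T.isSchwartzOperator α α' β β').ne
      ((apply_nonneg _ _).trans h)).2 h
  refine (withSeminorms N).congr ?_ ?_
  · rintro (⟨α, β⟩ | ⟨α, β⟩)
    · exact ⟨{(α, 0, β, 0)}, 1, by simp [halfSeminormFamily, seminormFamily]⟩
    · exact ⟨{(0, α, 0, β)}, 1, by simp [halfSeminormFamily, seminormFamily]⟩
  · rintro ⟨α, α', β, β'⟩
    classical
    -- The indices of the six one-sided bounds used by `FormBound.of_half`, which loses no constant;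
    -- hence the factor `1` below.
    let s : Finset ((MultiIdx N × MultiIdx N) ⊕ (MultiIdx N × MultiIdx N)) :=
      {Sum.inl (α + α + (α + α), β), Sum.inl (0, β + β), Sum.inl (0, β + β + (β + β)),
        Sum.inr (α' + α' + (α' + α'), β'), Sum.inr (0, β' + β'), Sum.inr (0, β' + β' + (β' + β'))}
    refine ⟨s, 1, fun T => ?_⟩
    rw [Seminorm.comp_apply, one_smul, LinearMap.id_apply]
    have hC : 0 ≤ s.sup (halfSeminormFamily N) T := apply_nonneg _ _
    have hl (α β : MultiIdx N) (hi : Sum.inl (α, β) ∈ s) :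
        FormBound T.toCLM (s.sup (halfSeminormFamily N) T) α 0 β 0 :=
      hsn _ _ _ _ _ _ (Seminorm.le_finset_sup_apply (p := halfSeminormFamily N) hi)
    have hr (α β : MultiIdx N) (hi : Sum.inr (α, β) ∈ s) :
        FormBound T.toCLM (s.sup (halfSeminormFamily N) T) 0 α 0 β :=
      hsn _ _ _ _ _ _ (Seminorm.le_finset_sup_apply (p := halfSeminormFamily N) hi)
    refine ENNReal.toReal_le_of_le_ofReal hC ((opNorm_le_ofReal_iff hC).2 ?_)
    refine FormBound.of_half (fun α β => opNorm_lt_top_iff.1 (T.isSchwartzOperator _ _ _ _))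
      (fun α β => opNorm_lt_top_iff.1 (T.isSchwartzOperator _ _ _ _)) hC
      (hl _ _ ?_) (hl _ _ ?_) (hl _ _ ?_) (hr _ _ ?_) (hr _ _ ?_) (hr _ _ ?_) <;>
    simp [s]

end FormBounds

end SchwartzOperator

/-! ### Regularity of vectors stable under adjoint positions and momenta -/

/-- A family of smooth functions which decay faster than any polynomial and which is stable under
the partial derivatives consists of Schwartz functions. -/
theorem SchwartzMap.exists_coe_eq_of_stable {N : ℕ} (G : Set (EuclideanSpace ℝ (Fin N) → ℂ))
    (hc : ∀ g ∈ G, ContDiff ℝ ((⊤ : ℕ∞) : WithTop ℕ∞) g)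
    (hb : ∀ g ∈ G, ∀ k : ℕ, ∃ C : ℝ, ∀ x, ‖x‖ ^ k * ‖g x‖ ≤ C)
    (hd : ∀ g ∈ G, ∀ i, ∃ g' ∈ G, ∀ x, fderiv ℝ g x (EuclideanSpace.single i 1) = g' x)
    {g : EuclideanSpace ℝ (Fin N) → ℂ} (hg : g ∈ G) :
    ∃ f : 𝓢(EuclideanSpace ℝ (Fin N), ℂ), ⇑f = g := by
  have key (n : ℕ) : ∀ g ∈ G, ∀ k : ℕ, ∃ C : ℝ, ∀ x, ‖x‖ ^ k * ‖iteratedFDeriv ℝ n g x‖ ≤ C := by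
    induction n with
    | zero => simpa using hb
    | succ n ih =>
      intro g hg k
      choose g' hg' hfg using hd g hg
      choose C hC using fun i => ih (g' i) (hg' i) k
      let L (i : Fin N) : ℂ →L[ℝ] (EuclideanSpace ℝ (Fin N) →L[ℝ] ℂ) :=
        ContinuousLinearMap.smulRightL ℝ (EuclideanSpace ℝ (Fin N)) ℂ (EuclideanSpace.proj i)
      -- The derivative is assembled from the partial derivatives, which lie in `G`; order `n + 1`
      -- for `g` thus reduces to order `n` for the `g' i`.
      have hf : fderiv ℝ g = ∑ i, (L i) ∘ (g' i) := by
        ext1 x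
        ext y
        rw [Finset.sum_apply, sum_apply]
        conv_lhs => rw [← (EuclideanSpace.basisFun (Fin N) ℝ).sum_repr y, map_sum]
        refine Finset.sum_congr rfl fun i _ => ?_
        rw [map_smul, EuclideanSpace.basisFun_apply, hfg]
        simp [L]
      have hcd (i : Fin N) (x) : ContDiffAt ℝ n (g' i) x :=
        ((hc _ (hg' i)).of_le (by exact_mod_cast le_top)).contDiffAt
      refine ⟨∑ i, ‖L i‖ * C i, fun x => ?_⟩
      rw [← norm_iteratedFDeriv_fderiv, hf, iteratedFDeriv_sum_apply fun i _ =>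
        (L i).contDiff.contDiffAt.comp x (hcd i x)]
      calc _ ≤ ‖x‖ ^ k * ∑ i, ‖L i‖ * ‖iteratedFDeriv ℝ n (g' i) x‖ := by
            gcongr
            refine (norm_sum_le _ _).trans (Finset.sum_le_sum fun i _ => ?_)
            exact (L i).norm_iteratedFDeriv_comp_left (hcd i x) le_rfl
        _ = ∑ i, ‖L i‖ * (‖x‖ ^ k * ‖iteratedFDeriv ℝ n (g' i) x‖) := by
            rw [Finset.mul_sum]; congr! 1; ring
        _ ≤ _ := by gcongr with i; exact hC i x
  exact ⟨⟨g, hc g hg, fun k n => key n g hg k⟩, rfl⟩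

namespace SchwartzOperator

section Regularity

variable {N : ℕ}

theorem locallyIntegrable_coe (h : L2 N) : LocallyIntegrable (h : EuclideanSpace ℝ (Fin N) → ℂ) :=
  (Lp.memLp h).locallyIntegrable one_le_two

theorem ae_eq_of_forall_integral_conj_mul {u v : EuclideanSpace ℝ (Fin N) → ℂ}
    (hu : LocallyIntegrable u) (hv : LocallyIntegrable v)
    (H : ∀ ψ : SchwartzFun N, ∫ x, conj (ψ x) * u x = ∫ x, conj (ψ x) * v x) :
    u =ᵐ[volume] v := by
  refine ae_eq_of_integral_contDiff_smul_eq hu hv fun g hg hgs => ?_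
  -- Real test functions suffice, so the conjugation disappears.
  have hgs' : HasCompactSupport fun x => (g x : ℂ) := hgs.comp_left (g := Complex.ofReal) rfl
  have hg' : ContDiff ℝ _ fun x => (g x : ℂ) := Complex.ofRealCLM.contDiff.comp hg
  have e (x) : hgs'.toSchwartzMap hg' x = (g x : ℂ) := rfl
  simpa only [e, Complex.conj_ofReal, Complex.real_smul] using H (hgs'.toSchwartzMap hg')

/-- `h'` is the image of `h` under the adjoint of `A`. -/
def IsAdjointImage (A : SchwartzFun N →L[ℂ] SchwartzFun N) (h h' : L2 N) : Prop :=
  ∀ ψ : SchwartzFun N, ⟪toL2 ψ, h'⟫_ℂ = ⟪toL2 (A ψ), h⟫_ℂ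

theorem IsAdjointImage.ae_eq {A : SchwartzFun N →L[ℂ] SchwartzFun N} {h h' : L2 N}
    (H : IsAdjointImage A h h') {m : EuclideanSpace ℝ (Fin N) → ℂ} (hm : Continuous m)
    (hA : ∀ f x, A f x = m x * f x) :
    (h' : EuclideanSpace ℝ (Fin N) → ℂ) =ᵐ[volume] fun x => conj (m x) * h x := by
  refine ae_eq_of_forall_integral_conj_mul (locallyIntegrable_coe h')
    ((locallyIntegrable_coe h).continuous_smul (Complex.continuous_conj.comp hm)) fun ψ => ?_
  rw [← inner_toL2_left, H, inner_toL2_left]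
  simp only [hA, map_mul]
  congr! 2; ring

theorem IsAdjointImage.fourierInv_ae_eq {A : SchwartzFun N →L[ℂ] SchwartzFun N} {h h' : L2 N}
    (H : IsAdjointImage A h h') {m : EuclideanSpace ℝ (Fin N) → ℂ} (hm : Continuous m)
    (hA : ∀ f ξ, 𝓕⁻ (A f) ξ = m ξ * 𝓕⁻ f ξ) :
    ((𝓕⁻ h' : L2 N) : EuclideanSpace ℝ (Fin N) → ℂ) =ᵐ[volume]
      fun ξ => conj (m ξ) * (𝓕⁻ h : L2 N) ξ := by
  let M : SchwartzFun N →L[ℂ] SchwartzFun N :=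
    FourierTransform.fourierInvCLM ℂ (SchwartzFun N) ∘L A ∘L
      FourierTransform.fourierCLM ℂ (SchwartzFun N)
  have hM (f : SchwartzFun N) : M f = 𝓕⁻ (A (𝓕 f)) := rfl
  refine IsAdjointImage.ae_eq (A := M) (fun ψ => ?_) hm fun f x => ?_
  · rw [hM, ← toL2_fourierInv, inner_fourierInv, ← H, ← toL2_fourier, ← inner_fourierInv (𝓕 _),
      FourierTransform.fourierInv_fourier_eq]
  · rw [hM, hA, FourierTransform.fourierInv_fourier_eq]

/-- The operators on the Schwartz space whose adjoints map `W` to itself. -/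
def adjointStabilizer (W : Submodule ℂ (L2 N)) :
    Subalgebra ℂ (SchwartzFun N →L[ℂ] SchwartzFun N) where
  carrier := {A | ∀ h ∈ W, ∃ h' ∈ W, IsAdjointImage A h h'}
  mul_mem' {A B} hA hB h hh := by
    obtain ⟨h₁, hh₁, e₁⟩ := hA h hh
    obtain ⟨h₂, hh₂, e₂⟩ := hB h₁ hh₁
    exact ⟨h₂, hh₂, fun ψ => by rw [e₂, e₁, mul_apply_eq_comp]⟩
  add_mem' {A B} hA hB h hh := by
    obtain ⟨h₁, hh₁, e₁⟩ := hA h hh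
    obtain ⟨h₂, hh₂, e₂⟩ := hB h hh
    exact ⟨h₁ + h₂, W.add_mem hh₁ hh₂, fun ψ => by
      rw [inner_add_right, e₁, e₂, add_apply, toL2_add, inner_add_left]⟩
  algebraMap_mem' c h hh := ⟨conj c • h, W.smul_mem _ hh, fun ψ => by
    rw [inner_smul_right, Algebra.algebraMap_eq_smul_one, smul_apply, one_apply_eq_self,
      toL2_smul, inner_smul_left]⟩

/-- On integrable functions in `L²`, the Fourier transform is given by the Fourier integral. -/
theorem fourier_coe_ae_eq {u : L2 N} (hu : Integrable (u : EuclideanSpace ℝ (Fin N) → ℂ))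
    (hc : Continuous (𝓕 (u : EuclideanSpace ℝ (Fin N) → ℂ))) :
    𝓕 (u : EuclideanSpace ℝ (Fin N) → ℂ) =ᵐ[volume] ((𝓕 u : L2 N) : EuclideanSpace ℝ (Fin N) → ℂ) := by
  refine ae_eq_of_forall_integral_conj_mul hc.locallyIntegrable (locallyIntegrable_coe _) fun ψ => ?_
  rw [← inner_toL2_left, ← inner_fourierInv_left, toL2_fourierInv, inner_toL2_left]
  -- For the pairing `-innerₗ` the Fourier integral is `𝓕⁻`; moving it across the sesquilinear
  -- integral flips the sign and produces `𝓕` on `u`.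
  have := VectorFourier.integral_sesq_fourierIntegral_eq_neg_flip (innerSL ℂ (E := ℂ))
    (L := -innerₗ (EuclideanSpace ℝ (Fin N))) Real.continuous_fourierChar
    (by simpa using! continuous_inner.neg) (ψ.integrable (μ := volume)) hu
  have hflip : -(-innerₗ (EuclideanSpace ℝ (Fin N))).flip = innerₗ (EuclideanSpace ℝ (Fin N)) := by
    ext x y; simp [real_inner_comm]
  rw [hflip] at this
  simp only [SchwartzMap.fourierInv_coe]
  simp only [coe_innerSL_apply, RCLike.inner_apply, mul_comm _ (conj _)] at this
  exact this.symm

/-- A single element of the operator algebra whose powers dominate every power of `‖x‖`. -/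
theorem sum_position_sq_apply (f : SchwartzFun N) (x : EuclideanSpace ℝ (Fin N)) :
    (1 + ∑ i, position i * position i) f x = ((1 + ‖x‖ ^ 2 : ℝ) : ℂ) * f x := by
  simp only [add_apply, sum_apply, one_apply_eq_self, mul_apply_eq_comp, position_apply,
    EuclideanSpace.real_norm_sq_eq]
  push_cast
  rw [add_mul, Finset.sum_mul, one_mul]
  congr! 2; ring

theorem fourierInv_sum_momentum_sq_apply (f : SchwartzFun N) (ξ : EuclideanSpace ℝ (Fin N)) :
    𝓕⁻ ((1 + ∑ i, momentum i * momentum i) f) ξ =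
      ((1 + ‖(2 * Real.pi) • ξ‖ ^ 2 : ℝ) : ℂ) * 𝓕⁻ f ξ := by
  have h (g : SchwartzFun N) : 𝓕⁻ g = FourierTransform.fourierInvCLM ℂ (SchwartzFun N) g := rfl
  have h' (i : Fin N) (g : SchwartzFun N) := fourierInv_momentum_apply i g ξ
  simp only [h] at h' ⊢
  simp only [add_apply, sum_apply, one_apply_eq_self, mul_apply_eq_comp, map_add, map_sum, h',
    EuclideanSpace.real_norm_sq_eq]
  push_cast
  rw [add_mul, Finset.sum_mul, one_mul]
  congr! 2
  simp
  ring

/-- With `l` such that `(1 + ‖ξ‖)^(-l)` is in `L²`, and `(1 + ‖2πξ‖²)^(k+l) 𝓕⁻ h` in `L²` by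
stability of `W`, the product of the two is integrable by Cauchy–Schwarz and dominates up to the
factor `2^(k+l)`. -/
theorem integrable_norm_pow_mul {W : Submodule ℂ (L2 N)}
    (hP : ∀ i, momentum i ∈ adjointStabilizer W) {h : L2 N} (hh : h ∈ W) (k : ℕ) :
    Integrable fun ξ => ‖ξ‖ ^ k * ‖(𝓕⁻ h : L2 N) ξ‖ := by
  obtain ⟨l, hl⟩ := Measure.HasTemperateGrowth.exists_eLpNorm_lt_top 2
    (μ := (volume : Measure (EuclideanSpace ℝ (Fin N)))) inferInstance
  have hmem : (1 + ∑ i, momentum i * momentum i) ^ (k + l) ∈ adjointStabilizer W :=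
    pow_mem (add_mem (one_mem _) (sum_mem fun i _ => mul_mem (hP i) (hP i))) _
  obtain ⟨h', hh', e⟩ := hmem h hh
  have hA (f : SchwartzFun N) (ξ) : 𝓕⁻ (((1 + ∑ i, momentum i * momentum i) ^ (k + l)) f) ξ =
      (((1 + ‖(2 * Real.pi) • ξ‖ ^ 2) ^ (k + l) : ℝ) : ℂ) * 𝓕⁻ f ξ := by
    generalize k + l = n
    induction n with
    | zero => simp
    | succ n ih =>
      rw [pow_succ', mul_apply_eq_comp, fourierInv_sum_momentum_sq_apply, ih]
      push_cast; ring
  have hae := e.fourierInv_ae_eq (by fun_prop) hA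
  have hw : MemLp (fun ξ : EuclideanSpace ℝ (Fin N) => (1 + ‖ξ‖) ^ (-l : ℝ)) 2 volume := by
    refine ⟨Continuous.aestronglyMeasurable ?_, hl⟩
    exact Continuous.rpow_const (by fun_prop) fun ξ => Or.inl (by positivity)
  have hint := (hw.integrable_mul (Lp.memLp (𝓕⁻ h' : L2 N)).norm).const_mul (2 ^ (k + l))
  refine hint.mono' (by fun_prop) ?_
  filter_upwards [hae] with ξ hξ
  have h1 : (0 : ℝ) < 1 + ‖ξ‖ := by positivity
  have h2 : 1 + ‖ξ‖ ≤ 2 * (1 + ‖(2 * Real.pi) • ξ‖ ^ 2) := by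
    rw [norm_smul, mul_pow, Real.norm_of_nonneg (by positivity)]
    have h3 : 1 ≤ (2 * Real.pi) ^ 2 := one_le_pow₀ (by linarith [Real.pi_gt_three])
    nlinarith [mul_le_mul_of_nonneg_right h3 (sq_nonneg ‖ξ‖), sq_nonneg (‖ξ‖ - 1 / 2)]
  rw [Real.norm_of_nonneg (by positivity), Pi.mul_apply, hξ, Complex.conj_ofReal,
    norm_mul, Complex.norm_real, Real.norm_of_nonneg (by positivity), Real.rpow_neg h1.le,
    Real.rpow_natCast]
  calc ‖ξ‖ ^ k * ‖(𝓕⁻ h : L2 N) ξ‖ ≤ (1 + ‖ξ‖) ^ k * ‖(𝓕⁻ h : L2 N) ξ‖ := by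
        gcongr; linarith
    _ = ((1 + ‖ξ‖) ^ l)⁻¹ * ((1 + ‖ξ‖) ^ (k + l) * ‖(𝓕⁻ h : L2 N) ξ‖) := by
        rw [pow_add]; field_simp
    _ ≤ ((1 + ‖ξ‖) ^ l)⁻¹ * ((2 * (1 + ‖(2 * Real.pi) • ξ‖ ^ 2)) ^ (k + l) *
          ‖(𝓕⁻ h : L2 N) ξ‖) := by gcongr
    _ = _ := by rw [mul_pow]; ring

/-- A vector of `L²(ℝᴺ)` to which the adjoints of the position and momentum operators can be
applied any number of times is a Schwartz function. -/
theorem exists_toL2_eq_of_stable {W : Submodule ℂ (L2 N)}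
    (hQ : ∀ i, position i ∈ adjointStabilizer W) (hP : ∀ i, momentum i ∈ adjointStabilizer W)
    {h : L2 N} (hh : h ∈ W) : ∃ f : SchwartzFun N, toL2 f = h := by
  let rep (h : L2 N) : EuclideanSpace ℝ (Fin N) → ℂ :=
    𝓕 ((𝓕⁻ h : L2 N) : EuclideanSpace ℝ (Fin N) → ℂ)
  have hint {h : L2 N} (hh : h ∈ W) :
      Integrable ((𝓕⁻ h : L2 N) : EuclideanSpace ℝ (Fin N) → ℂ) := by
    rw [← integrable_norm_iff (by fun_prop)]
    simpa using integrable_norm_pow_mul hP hh 0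
  have hcd {h : L2 N} (hh : h ∈ W) : ContDiff ℝ ((⊤ : ℕ∞) : WithTop ℕ∞) (rep h) :=
    Real.contDiff_fourier fun n _ => integrable_norm_pow_mul hP hh n
  have hae {h : L2 N} (hh : h ∈ W) : rep h =ᵐ[volume] h := by
    have := fourier_coe_ae_eq (hint hh) (hcd hh).continuous
    rwa [FourierTransform.fourier_fourierInv_eq] at this
  suffices H : ∃ f : SchwartzFun N, ⇑f = rep h by
    obtain ⟨f, hf⟩ := H
    refine ⟨f, Lp.ext ?_⟩
    filter_upwards [f.coeFn_toLp 2 volume, hae hh] with x h1 h2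
    rw [toL2, h1, hf, h2]
  refine SchwartzMap.exists_coe_eq_of_stable {g | ∃ h ∈ W, g = rep h} (g := rep h)
    (by rintro _ ⟨h, hh, rfl⟩; exact hcd hh) ?_ ?_ ⟨h, hh, rfl⟩
  · rintro _ ⟨h, hh, rfl⟩ k
    have hmem : (1 + ∑ i, position i * position i) ^ k ∈ adjointStabilizer W :=
      pow_mem (add_mem (one_mem _) (sum_mem fun i _ => mul_mem (hQ i) (hQ i))) _
    obtain ⟨h', hh', e⟩ := hmem h hh
    have hA (f : SchwartzFun N) (x) : ((1 + ∑ i, position i * position i) ^ k) f x =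
        (((1 + ‖x‖ ^ 2) ^ k : ℝ) : ℂ) * f x := by
      clear hmem e
      induction k with
      | zero => simp
      | succ n ih =>
        rw [pow_succ', mul_apply_eq_comp, sum_position_sq_apply, ih]
        push_cast; ring
    -- Both sides are continuous, so almost everywhere equality is equality. Decay of `rep h` then
    -- follows because `rep h'`, a Fourier integral, is bounded by an `L¹` norm.
    have heq : rep h' = fun x => (((1 + ‖x‖ ^ 2) ^ k : ℝ) : ℂ) * rep h x := by
      refine (Continuous.ae_eq_iff_eq volume (hcd hh').continuous
        (Continuous.mul (by fun_prop) (hcd hh).continuous)).1 ?_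
      filter_upwards [hae hh, hae hh', e.ae_eq (by fun_prop) hA] with x h1 h2 h3
      rw [Pi.mul_apply, h2, h3, h1, Complex.conj_ofReal]
    refine ⟨∫ ξ, ‖(𝓕⁻ h' : L2 N) ξ‖, fun x => ?_⟩
    calc ‖x‖ ^ k * ‖rep h x‖ ≤ (1 + ‖x‖ ^ 2) ^ k * ‖rep h x‖ := by
          gcongr; nlinarith [sq_nonneg (‖x‖ - 1 / 2)]
      _ = ‖rep h' x‖ := by
          rw [heq, norm_mul, Complex.norm_real, Real.norm_of_nonneg (by positivity)]
      _ ≤ _ := VectorFourier.norm_fourierIntegral_le_integral_norm _ _ _ _ _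
  · rintro _ ⟨h, hh, rfl⟩ i
    -- The formal adjoint of `-i P_i` is `i P_i = ∂_i`. On the Fourier side it multiplies by `-2πi
    -- ξ_i`, the factor from differentiating the Fourier integral.
    have hmem : (-Complex.I) • momentum i ∈ adjointStabilizer W := Subalgebra.smul_mem _ (hP i) _
    obtain ⟨h', hh', e⟩ := hmem h hh
    have hA (f : SchwartzFun N) (ξ) : 𝓕⁻ (((-Complex.I) • momentum i) f) ξ =
        (2 * Real.pi * Complex.I * ξ i) * 𝓕⁻ f ξ := by
      rw [smul_apply, FourierTransform.fourierInv_smul, smul_apply, fourierInv_momentum_apply]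
      push_cast
      simp only [smul_eq_mul]
      ring
    refine ⟨rep h', ⟨h', hh', rfl⟩, fun x => ?_⟩
    have h1 : Integrable fun v => ‖v‖ * ‖(𝓕⁻ h : L2 N) v‖ := by
      simpa using integrable_norm_pow_mul hP hh 1
    rw [(Real.hasFDerivAt_fourier (hint hh) h1 x).fderiv,
      Real.fourier_continuousLinearMap_apply ?_]
    · simp only [rep, Real.fourier_eq]
      refine integral_congr_ae ?_
      filter_upwards [e.fourierInv_ae_eq (by fun_prop) hA] with v hv
      rw [hv]
      congr 1
      simp [innerSL_apply_apply ℝ, EuclideanSpace.inner_single_right, Complex.conj_ofNat]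
      ring
    · refine Integrable.mono' (h1.const_mul (2 * Real.pi * ‖innerSL ℝ (E := EuclideanSpace ℝ (Fin N))‖))
        ((Lp.memLp (𝓕⁻ h : L2 N)).aestronglyMeasurable.fourierSMulRight) (ae_of_all _ fun v => ?_)
      exact (VectorFourier.norm_fourierSMulRight_le _ _ v).trans_eq (by ring)

end Regularity

end SchwartzOperator

namespace SchwartzOperator

/-! ### Normal ordering in the algebra of positions and momenta -/

section Words

variable {N : ℕ}

/-- For `α i = 0` the truncated `α - Pi.single i 1` is `α`, which is harmless since the factor `α i`
vanishes. -/
theorem hasLineDerivAt_monomial (α : MultiIdx N) (i : Fin N) (q : EuclideanSpace ℝ (Fin N)) :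
    HasLineDerivAt ℝ (monomial α) (α i * monomial (α - Pi.single i 1) q) q
      (EuclideanSpace.single i 1) := by
  have h1 (t : ℝ) : monomial α (q + t • EuclideanSpace.single i (1 : ℝ)) =
      (q i + t) ^ α i * ∏ j ∈ Finset.univ.erase i, q j ^ α j := by
    rw [monomial, ← Finset.mul_prod_erase _ _ (Finset.mem_univ i)]
    congr 1
    · simp
    · refine Finset.prod_congr rfl fun j hj => ?_
      simp [Finset.ne_of_mem_erase hj]
  have h2 : monomial (α - Pi.single i 1) q =
      q i ^ (α i - 1) * ∏ j ∈ Finset.univ.erase i, q j ^ α j := by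
    rw [monomial, ← Finset.mul_prod_erase _ _ (Finset.mem_univ i)]
    congr 1
    · simp
    · refine Finset.prod_congr rfl fun j hj => ?_
      simp [Finset.ne_of_mem_erase hj]
  rw [HasLineDerivAt, funext h1, h2, ← mul_assoc]
  refine HasDerivAt.mul_const ?_ _
  simpa using! ((hasDerivAt_id (0 : ℝ)).const_add (q i)).fun_pow (α i)

/-- The commutation relation, from the Leibniz rule; it moves a momentum to the left of a position
monomial. -/
theorem positionPow_momentum (α : MultiIdx N) (i : Fin N) (f : SchwartzFun N) :
    positionPow α (momentum i f) = momentum i (positionPow α f) +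
      (Complex.I * α i) • positionPow (α - Pi.single i 1) f := by
  ext q
  rw [add_apply, smul_apply, positionPow_apply, momentum_apply, momentum_apply, positionPow_apply]
  have h1 : HasLineDerivAt ℝ (fun q => (monomial α q : ℂ))
      ((α i * monomial (α - Pi.single i 1) q : ℝ) : ℂ) q (EuclideanSpace.single i 1) :=
    HasDerivAt.ofReal_comp (hasLineDerivAt_monomial α i q)
  have h2 : HasLineDerivAt ℝ f (lineDeriv ℝ f q (EuclideanSpace.single i 1)) q
      (EuclideanSpace.single i 1) := (f.differentiableAt.lineDifferentiableAt).hasLineDerivAt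
  have h3 : HasLineDerivAt ℝ (fun q => (monomial α q : ℂ) * f q) _ q
      (EuclideanSpace.single i 1) := HasDerivAt.fun_mul h1 h2
  rw [show ⇑(positionPow α f) = fun q => (monomial α q : ℂ) * f q from
    funext (positionPow_apply α f), h3.lineDeriv]
  simp only [zero_smul, add_zero, smul_eq_mul]
  push_cast
  ring

/-- The algebra generated by the position and momentum operators. -/
noncomputable def weylAlgebra (N : ℕ) : Subalgebra ℂ (SchwartzFun N →L[ℂ] SchwartzFun N) :=
  Algebra.adjoin ℂ (Set.range position ∪ Set.range momentum)

theorem position_mem_weylAlgebra (i : Fin N) : position i ∈ weylAlgebra N :=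
  Algebra.subset_adjoin (Or.inl ⟨i, rfl⟩)

theorem momentum_mem_weylAlgebra (i : Fin N) : momentum i ∈ weylAlgebra N :=
  Algebra.subset_adjoin (Or.inr ⟨i, rfl⟩)

/-- The span is closed under right multiplication by each `Q_i` trivially and by each `P_i` through
the commutation relation, hence by the whole algebra; it contains `1`. -/
theorem weylAlgebra_le_span {A : SchwartzFun N →L[ℂ] SchwartzFun N} (hA : A ∈ weylAlgebra N) :
    A ∈ Submodule.span ℂ
      (Set.range fun p : MultiIdx N × MultiIdx N => momentumPow p.1 * positionPow p.2) := by
  set L := Submodule.span ℂ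
    (Set.range fun p : MultiIdx N × MultiIdx N => momentumPow p.1 * positionPow p.2)
  have hL (β α : MultiIdx N) : momentumPow β * positionPow α ∈ L :=
    Submodule.subset_span ⟨(β, α), rfl⟩
  have hgen {A : SchwartzFun N →L[ℂ] SchwartzFun N}
      (H : ∀ β α, momentumPow β * positionPow α * A ∈ L) : ∀ B ∈ L, B * A ∈ L := by
    intro B hB
    induction hB using Submodule.span_induction with
    | mem x hx => obtain ⟨p, rfl⟩ := hx; exact H _ _
    | zero => rw [zero_mul]; exact L.zero_mem
    | add x y _ _ hx hy => rw [add_mul]; exact L.add_mem hx hy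
    | smul c x _ hx => rw [smul_mul_assoc]; exact L.smul_mem _ hx
  have key : ∀ B ∈ L, B * A ∈ L := by
    induction hA using Algebra.adjoin_induction with
    | mem x hx =>
      refine hgen fun β α => ?_
      rcases hx with ⟨i, rfl⟩ | ⟨i, rfl⟩
      · convert hL β (α + Pi.single i 1) using 1
        ext1 f
        simp only [mul_apply_eq_comp, positionPow_add, positionPow_single]
      · have : momentumPow β * positionPow α * momentum i =
            momentumPow (β + Pi.single i 1) * positionPow α +
              (Complex.I * α i) • (momentumPow β * positionPow (α - Pi.single i 1)) := by
          ext1 f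
          simp only [mul_apply_eq_comp, add_apply, smul_apply, momentumPow_add, momentumPow_single,
            positionPow_momentum, map_add, map_smul]
        rw [this]
        exact L.add_mem (hL _ _) (L.smul_mem _ (hL _ _))
    | algebraMap c =>
      intro B hB
      rw [← Algebra.commutes, ← Algebra.smul_def]
      exact L.smul_mem _ hB
    | add x y _ _ hx hy => intro B hB; rw [mul_add]; exact L.add_mem (hx B hB) (hy B hB)
    | mul x y _ _ hx hy => intro B hB; rw [← mul_assoc]; exact hy _ (hx B hB)
  have h1 : (1 : SchwartzFun N →L[ℂ] SchwartzFun N) ∈ L := by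
    convert hL 0 0 using 1
    ext1 f
    simp only [mul_apply_eq_comp, positionPow_zero, momentumPow_zero, one_apply_eq_self]
  simpa using key 1 h1

/-- A vector of `L²(ℝᴺ)` all of whose moments `ψ ↦ ⟨P^β Q^α ψ, h⟩` are `L²`-bounded is a Schwartz
function. -/
theorem exists_toL2_eq_of_bounded {h : L2 N} (H : ∀ α β : MultiIdx N, ∃ C : ℝ, ∀ ψ : SchwartzFun N,
    ‖⟪toL2 (momentumPow β (positionPow α ψ)), h⟫_ℂ‖ ≤ C * ‖toL2 ψ‖) :
    ∃ f : SchwartzFun N, toL2 f = h := by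
  -- Asking for the adjoint images under the whole algebra makes `W` stable: an image of `u` under
  -- `A`'s adjoint is tested on `B` by using `A * B` on `u`. By normal ordering the assumed bounds
  -- put `h` in `W`.
  let W : Submodule ℂ (L2 N) :=
    { carrier := {h | ∀ A ∈ weylAlgebra N, ∃ h', IsAdjointImage A h h'}
      add_mem' := fun {u v} hu hv A hA => by
        obtain ⟨u', hu'⟩ := hu A hA
        obtain ⟨v', hv'⟩ := hv A hA
        exact ⟨u' + v', fun ψ => by rw [inner_add_right, inner_add_right, hu', hv']⟩
      zero_mem' := fun A _ => ⟨0, fun ψ => by rw [inner_zero_right, inner_zero_right]⟩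
      smul_mem' := fun c u hu A hA => by
        obtain ⟨u', hu'⟩ := hu A hA
        exact ⟨c • u', fun ψ => by rw [inner_smul_right, inner_smul_right, hu']⟩ }
  have hstab {A : SchwartzFun N →L[ℂ] SchwartzFun N} (hA : A ∈ weylAlgebra N) :
      A ∈ adjointStabilizer W := by
    intro u hu
    obtain ⟨u', hu'⟩ := hu A hA
    refine ⟨u', fun B hB => ?_, hu'⟩
    obtain ⟨u'', hu''⟩ := hu (A * B) (mul_mem hA hB)
    exact ⟨u'', fun ψ => by rw [hu'', hu', mul_apply_eq_comp]⟩
  refine exists_toL2_eq_of_stable (W := W) (fun i => hstab (position_mem_weylAlgebra i))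
    (fun i => hstab (momentum_mem_weylAlgebra i)) fun A hA => ?_
  have hA' := weylAlgebra_le_span hA
  clear hA
  induction hA' using Submodule.span_induction with
  | mem x hx =>
    obtain ⟨⟨β, α⟩, rfl⟩ := hx
    obtain ⟨C, hC⟩ := H α β
    exact exists_inner_toL2_eq _ h C hC
  | zero => exact ⟨0, fun ψ => by rw [inner_zero_right, zero_apply, toL2_zero, inner_zero_left]⟩
  | add x y _ _ hx hy =>
    obtain ⟨u, hu⟩ := hx
    obtain ⟨v, hv⟩ := hy
    exact ⟨u + v, fun ψ => by rw [inner_add_right, hu, hv, add_apply, toL2_add, inner_add_left]⟩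
  | smul c x _ hx =>
    obtain ⟨u, hu⟩ := hx
    exact ⟨conj c • u, fun ψ => by rw [inner_smul_right, hu, smul_apply, toL2_smul, inner_smul_left]⟩

end Words

/-! ### Ranges, adjoints and the one-sided seminorms -/

section Range

variable {N : ℕ}

theorem inner_momentumPow_positionPow (α β : MultiIdx N) (f g : SchwartzFun N) :
    ⟪toL2 (momentumPow β (positionPow α f)), toL2 g⟫_ℂ =
      ⟪toL2 f, toL2 (positionPow α (momentumPow β g))⟫_ℂ := by
  rw [inner_momentumPow, inner_positionPow]

theorem formBound_half_iff {T : L2 N →L[ℂ] L2 N} {C : ℝ} {α β : MultiIdx N} :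
    FormBound T C α 0 β 0 ↔ ∀ (ψ : SchwartzFun N) (φ : L2 N),
      ‖⟪toL2 (momentumPow β (positionPow α ψ)), T φ⟫_ℂ‖ ≤ C * ‖toL2 ψ‖ * ‖φ‖ := by
  simp only [FormBound, positionPow_zero, momentumPow_zero]
  refine ⟨fun h ψ φ => ?_, fun h ψ φ => h ψ _⟩
  exact denseRange_toL2.induction_on (p := fun φ =>
    ‖⟪toL2 (momentumPow β (positionPow α ψ)), T φ⟫_ℂ‖ ≤ C * ‖toL2 ψ‖ * ‖φ‖) φ
    (isClosed_le (by fun_prop) (by fun_prop)) (h ψ)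

theorem formBound_adjoint {T : L2 N →L[ℂ] L2 N} {C : ℝ} {α α' β β' : MultiIdx N} :
    FormBound (ContinuousLinearMap.adjoint T) C α α' β β' ↔ FormBound T C α' α β' β := by
  have (u v : L2 N) : ‖⟪u, ContinuousLinearMap.adjoint T v⟫_ℂ‖ = ‖⟪v, T u⟫_ℂ‖ := by
    rw [ContinuousLinearMap.adjoint_inner_right, norm_inner_symm]
  simp only [FormBound, this]
  exact ⟨fun h ψ φ => (h φ ψ).trans_eq (by ring), fun h ψ φ => (h φ ψ).trans_eq (by ring)⟩

theorem opNorm_adjoint (T : L2 N →L[ℂ] L2 N) (α α' β β' : MultiIdx N) :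
    opNorm α α' β β' (ContinuousLinearMap.adjoint T) = opNorm α' α β' β T := by
  refine eq_of_forall_ge_iff fun c => ?_
  induction c using ENNReal.recTopCoe with
  | top => simp
  | coe c =>
    rw [← ENNReal.ofReal_coe_nnreal, opNorm_le_ofReal_iff c.coe_nonneg, opNorm_le_ofReal_iff c.coe_nonneg,
      formBound_adjoint]

theorem range_subset_of_formBound {T : L2 N →L[ℂ] L2 N} (H : ∀ α β, ∃ C, FormBound T C α 0 β 0)
    (φ : L2 N) : ∃ f : SchwartzFun N, toL2 f = T φ := by
  refine exists_toL2_eq_of_bounded fun α β => ?_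
  obtain ⟨C, hC⟩ := H α β
  exact ⟨C * ‖φ‖, fun ψ => (formBound_half_iff.1 hC ψ φ).trans_eq (by ring)⟩

/-- Uniform boundedness for the functionals `φ ↦ ⟨P^β Q^α ψ, Tφ⟩` with `‖ψ‖ ≤ 1`: at fixed `φ` the
operators move onto the Schwartz function `Tφ`, which bounds them by its norm `‖Tφ‖_{α,β}`. -/
theorem exists_formBound_of_range {T : L2 N →L[ℂ] L2 N}
    (H : ∀ φ, ∃ f : SchwartzFun N, toL2 f = T φ) (α β : MultiIdx N) :
    ∃ C, FormBound T C α 0 β 0 := by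
  let g (ψ : {ψ : SchwartzFun N // ‖toL2 ψ‖ ≤ 1}) : L2 N →L[ℂ] ℂ :=
    innerSL ℂ (toL2 (momentumPow β (positionPow α ψ.1))) ∘L T
  have hg (ψ φ) : g ψ φ = ⟪toL2 (momentumPow β (positionPow α ψ.1)), T φ⟫_ℂ := rfl
  obtain ⟨C, hC⟩ := banach_steinhaus (g := g) fun φ => by
    obtain ⟨f, hf⟩ := H φ
    refine ⟨‖toL2 (positionPow α (momentumPow β f))‖, fun ψ => ?_⟩
    rw [hg, ← hf, inner_momentumPow_positionPow]
    exact (norm_inner_le_norm _ _).trans (mul_le_of_le_one_left (norm_nonneg _) ψ.2)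
  have hC0 : 0 ≤ C := (norm_nonneg _).trans (hC ⟨0, by simp [toL2_zero]⟩)
  refine ⟨C, (opNorm_le_ofReal_iff hC0).1 ?_⟩
  refine iSup_le fun ψ => iSup_le fun φ => iSup_le fun hψ => iSup_le fun hφ => ?_
  rw [← ofReal_norm, positionPow_zero, momentumPow_zero]
  refine ENNReal.ofReal_le_ofReal ?_
  calc _ ≤ C * ‖toL2 φ‖ := (g ⟨ψ, hψ⟩).le_of_opNorm_le (hC _) _
    _ ≤ C := mul_le_of_le_one_right hC0 hφ

theorem isSchwartzOperator_iff (T : L2 N →L[ℂ] L2 N) : IsSchwartzOperator T ↔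
    (∀ φ : L2 N, T φ ∈ schwartzSubspace N) ∧
      (∀ φ : L2 N, ContinuousLinearMap.adjoint T φ ∈ schwartzSubspace N) := by
  simp only [mem_schwartzSubspace]
  constructor
  · intro h
    refine ⟨range_subset_of_formBound fun α β => opNorm_lt_top_iff.1 (h α 0 β 0),
      range_subset_of_formBound fun α β => ?_⟩
    simp only [formBound_adjoint]
    exact opNorm_lt_top_iff.1 (h 0 α 0 β)
  · rintro ⟨h₁, h₂⟩
    refine isSchwartzOperator_of_half (exists_formBound_of_range h₁) fun α β => ?_
    simp only [← formBound_adjoint (T := T)]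
    exact exists_formBound_of_range h₂ α β

/-- By density the norm of `Q^α P^β Tφ` is detected by pairing with Schwartz `ψ`, which gives the
upper bound; Cauchy–Schwarz gives leastness. -/
theorem isLUB_vecNorm {T : L2 N →L[ℂ] L2 N} (hT : IsSchwartzOperator T) (α β : MultiIdx N) :
    IsLUB {r : ℝ | ∃ (φ : L2 N) (f : SchwartzFun N),
      ‖φ‖ ≤ 1 ∧ toL2 f = T φ ∧ r = vecNorm α β f} (opNorm α 0 β 0 T).toReal := by
  constructor
  · rintro _ ⟨φ, f, hφ, hf, rfl⟩
    have hb : FormBound T (opNorm α 0 β 0 T).toReal α 0 β 0 := by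
      rw [← opNorm_le_ofReal_iff ENNReal.toReal_nonneg, ENNReal.ofReal_toReal (hT _ _ _ _).ne]
    refine norm_le_of_forall_inner_toL2 ENNReal.toReal_nonneg fun ψ => ?_
    rw [← inner_momentumPow_positionPow, hf]
    exact (formBound_half_iff.1 hb ψ φ).trans (mul_le_of_le_one_right (by positivity) hφ)
  · intro b hb
    have hb0 : 0 ≤ b := hb ⟨0, 0, by simp, by simp [toL2_zero], by simp [vecNorm, toL2_zero]⟩
    refine ENNReal.toReal_le_of_le_ofReal hb0 ?_
    refine iSup_le fun ψ => iSup_le fun φ => iSup_le fun hψ => iSup_le fun hφ => ?_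
    obtain ⟨f, hf⟩ := mem_schwartzSubspace.1 (((isSchwartzOperator_iff T).1 hT).1 (toL2 φ))
    rw [← ofReal_norm, positionPow_zero, momentumPow_zero, ← hf, inner_momentumPow_positionPow]
    refine ENNReal.ofReal_le_ofReal ((norm_inner_le_norm _ _).trans ?_)
    exact (mul_le_of_le_one_left (norm_nonneg _) hψ).trans (hb ⟨toL2 φ, f, hφ, hf, rfl⟩)

end Range

end SchwartzOperator

theorem mainTheorem1 (N : ℕ) :
    (∀ T : L2 N →L[ℂ] L2 N, IsSchwartzOperator T ↔
      (∀ φ : L2 N, T φ ∈ schwartzSubspace N) ∧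
        (∀ φ : L2 N, ContinuousLinearMap.adjoint T φ ∈ schwartzSubspace N)) ∧
    (∀ (T : SchwartzOperator N) (α β : MultiIdx N),
      IsLUB {r : ℝ | ∃ (φ : L2 N) (f : SchwartzFun N),
          ‖φ‖ ≤ 1 ∧ toL2 f = T.toCLM φ ∧ r = vecNorm α β f}
        (SchwartzOperator.seminorm α 0 β 0 T) ∧
      IsLUB {r : ℝ | ∃ (φ : L2 N) (f : SchwartzFun N),
          ‖φ‖ ≤ 1 ∧ toL2 f = ContinuousLinearMap.adjoint T.toCLM φ ∧ r = vecNorm α β f}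
        (SchwartzOperator.seminorm 0 α 0 β T)) ∧
    WithSeminorms (SchwartzOperator.halfSeminormFamily N) := by
  refine ⟨SchwartzOperator.isSchwartzOperator_iff, fun T α β =>
    ⟨SchwartzOperator.isLUB_vecNorm T.isSchwartzOperator α β, ?_⟩,
    SchwartzOperator.withSeminorms_halfSeminormFamily N⟩
  -- The second formula is the first for `T*`, since passing to the adjoint exchanges the primed and
  -- unprimed indices.
  have h := SchwartzOperator.isLUB_vecNorm (T := ContinuousLinearMap.adjoint T.toCLM)
    (fun α α' β β' => by
      rw [SchwartzOperator.opNorm_adjoint]; exact T.isSchwartzOperator _ _ _ _) α β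
  rwa [SchwartzOperator.opNorm_adjoint] at h
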